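/- Let $M$ be a non-empty compact smooth manifold without boundary, of dimension $2n+1$ ($n\ge 0$). A \emph{contact Calabi--Yau structure} on $M$ is a triple $(\alpha,J,\epsilon)$ such that: (a) $\alpha$ is a contact form, i.e. a smooth $1$-form with $\alpha\wedge(d\alpha)^n$ nowhere zero; write $\xi=\ker\alpha$, $\kappa=\tfrac12 d\alpha$, and let $R_\alpha$ be the Reeb vector field, determined by $\alpha(R_\alpha)=1$ and $\iota_{R_\alpha}d\alpha=0$; (b) $J$ is a smooth endomorphism of $\xi$ with $J^2=-I_\xi$ such that $g_J(\cdot,\cdot)=\kappa(\cdot,J\cdot)$ is a $J$-Hermitian inner product on each $\xi_x$ and such that, after extending $J$ to $TM$ by $J(R_\alpha)=0$, its Nijenhuis tensor $$N_J(X,Y)=[JX,JY]-J[X,JY]-J[JX,Y]+J^2[X,Y]$$ satisfies $N_J=-d\alpha\otimes R_\alpha$ (that is, $(M,\alpha,J)$ is Sasakian; here $d\alpha(X,Y)=X\alpha(Y)-Y\alpha(X)-\alpha([X,Y])$); (c) $\epsilon$ is a smooth, nowhere vanishing, complex-valued $n$-form on $M$ which is basic ($\iota_{R_\alpha}\epsilon=0$,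 $\mathcal L_{R_\alpha}\epsilon=0$), of type $(n,0)$ on $\xi$ with respect to $J$ (it is complex linear in each argument: $\epsilon(\dots,JX,\dots)=i\,\epsilon(\dots,X,\dots)$ for arguments in $\xi$), closed ($d\epsilon=0$), and satisfies $$\epsilon\wedge\overline\epsilon=(-1)^{\frac{n(n+1)}2}(2i)^n\,\kappa^n .$$ Let $b_j(M)=\dim_{\mathbb R}H^j(M,\mathbb R)$ denote the $j$-th Betti number ($H^j(M,\mathbb R)$ being de Rham cohomology). If $M$ admits a contact Calabi--Yau structure, then: 1. if $n$ is even, then $b_{n+1}(M)>0$; 2. if $n$ is odd, then $b_n(M)\ge 2$ and $b_{n+1}(M)\ge 2$. -/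

import Mathlib

open scoped Manifold ContDiff
open Bundle

noncomputable section

namespace ContactCY

/-! ### Linear algebra: the wedge product -/

/-- The wedge product of alternating maps with values in a real algebra, normalised by
`(a ∧ b) (v) = ∑ sign(σ) a(v_{σ(1)}, …, v_{σ(k)}) b(v_{σ(k+1)}, …, v_{σ(k+l)})`,
the sum running over the `(k, l)`-shuffles. -/
def wedge {V A : Type*} [AddCommGroup V] [Module ℝ V] [CommRing A] [Algebra ℝ A] {k l : ℕ}
    (a : V [⋀^Fin k]→ₗ[ℝ] A) (b : V [⋀^Fin l]→ₗ[ℝ] A) : V [⋀^Fin (k + l)]→ₗ[ℝ] A :=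
  ((LinearMap.mul' ℝ A).compAlternatingMap (a.domCoprod b)).domDomCongr finSumFinEquiv

/-- The wedge power `θ ∧ ⋯ ∧ θ` (`p` factors) of an alternating `2`-form. -/
def wedgePow {V : Type*} [AddCommGroup V] [Module ℝ V] (θ : V [⋀^Fin 2]→ₗ[ℝ] ℝ) :
    (p : ℕ) → V [⋀^Fin (2 * p)]→ₗ[ℝ] ℝ
  | 0 => AlternatingMap.constOfIsEmpty ℝ V (Fin 0) (1 : ℝ)
  | p + 1 => wedge (wedgePow θ p) θ

/-! ### Differential forms on a manifold without boundary modelled on `ℝᵐ` -/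

/-- (Not necessarily smooth) differential `k`-forms on `M` with values in `F`. -/
abbrev DForm (m : ℕ) (M : Type*) [TopologicalSpace M]
    [ChartedSpace (EuclideanSpace ℝ (Fin m)) M]
    (F : Type*) [NormedAddCommGroup F] [NormedSpace ℝ F] (k : ℕ) :=
  (x : M) → TangentSpace (𝓡 m) x [⋀^Fin k]→L[ℝ] F

/-- Vector fields on `M`. -/
abbrev VField (m : ℕ) (M : Type*) [TopologicalSpace M]
    [ChartedSpace (EuclideanSpace ℝ (Fin m)) M] :=
  (x : M) → TangentSpace (𝓡 m) x

/-- Fields of endomorphisms of the tangent bundle of `M`. -/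
abbrev EndField (m : ℕ) (M : Type*) [TopologicalSpace M]
    [ChartedSpace (EuclideanSpace ℝ (Fin m)) M] :=
  (x : M) → TangentSpace (𝓡 m) x →L[ℝ] TangentSpace (𝓡 m) x

section Forms

variable {m : ℕ} {M : Type*} [TopologicalSpace M] [ChartedSpace (EuclideanSpace ℝ (Fin m)) M]
  {F : Type*} [NormedAddCommGroup F] [NormedSpace ℝ F] {k : ℕ}

/-- The expression of a form in the chart around `x₀`, i.e. its pullback under the inverse of
that chart. It is meaningful on the target of the chart. -/
def chartRep (θ : DForm m M F k) (x₀ : M) (y : EuclideanSpace ℝ (Fin m)) :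
    EuclideanSpace ℝ (Fin m) [⋀^Fin k]→L[ℝ] F :=
  (θ ((extChartAt (𝓡 m) x₀).symm y)).compContinuousLinearMap
    (mfderiv 𝓘(ℝ, EuclideanSpace ℝ (Fin m)) (𝓡 m) (extChartAt (𝓡 m) x₀).symm y)

/-- A form is smooth if its expressions in the charts are. -/
def SmoothForm (θ : DForm m M F k) : Prop :=
  ∀ x₀ : M, ContDiffOn ℝ ∞ (chartRep θ x₀) (extChartAt (𝓡 m) x₀).target

/-- The exterior derivative, computed at `x` in the chart around `x`. -/
def extD (θ : DForm m M F k) : DForm m M F (k + 1) := fun x =>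
  (extDeriv (chartRep θ x) (extChartAt (𝓡 m) x x)).compContinuousLinearMap
    (mfderiv (𝓡 m) 𝓘(ℝ, EuclideanSpace ℝ (Fin m)) (extChartAt (𝓡 m) x) x)

/-! ### De Rham cohomology and Betti numbers -/

lemma chartRep_add (θ η : DForm m M F k) (x₀ : M) :
    chartRep (θ + η) x₀ = chartRep θ x₀ + chartRep η x₀ := by
  ext; rfl

lemma chartRep_smul (c : ℝ) (θ : DForm m M F k) (x₀ : M) :
    chartRep (c • θ) x₀ = c • chartRep θ x₀ := by
  ext; rfl

lemma chartRep_zero (x₀ : M) : chartRep (0 : DForm m M F k) x₀ = 0 := by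
  ext; rfl

lemma SmoothForm.zero : SmoothForm (0 : DForm m M F k) := fun x₀ => by
  rw [chartRep_zero]; exact contDiffOn_const

lemma SmoothForm.add {θ η : DForm m M F k} (hθ : SmoothForm θ) (hη : SmoothForm η) :
    SmoothForm (θ + η) := fun x₀ => by
  rw [chartRep_add]; exact (hθ x₀).add (hη x₀)

lemma SmoothForm.smul (c : ℝ) {θ : DForm m M F k} (hθ : SmoothForm θ) :
    SmoothForm (c • θ) := fun x₀ => by
  rw [chartRep_smul]; exact (hθ x₀).const_smul c

lemma SmoothForm.differentiableAt {θ : DForm m M F k} (hθ : SmoothForm θ) (x : M) :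
    DifferentiableAt ℝ (chartRep θ x) (extChartAt (𝓡 m) x x) :=
  ((hθ x).contDiffAt (extChartAt_target_mem_nhds (I := 𝓡 m) x)).differentiableAt (by simp)

lemma extD_zero : extD (0 : DForm m M F k) = 0 := by
  funext x
  have h : extDeriv (chartRep (0 : DForm m M F k) x) (extChartAt (𝓡 m) x x) = 0 := by
    have := extDeriv_smul (0 : ℝ) (chartRep (0 : DForm m M F k) x) (x := extChartAt (𝓡 m) x x)
    rwa [zero_smul, zero_smul, ← chartRep_zero x] at this
  ext v
  simp only [extD, h]
  rfl

lemma extD_add {θ η : DForm m M F k} (hθ : SmoothForm θ) (hη : SmoothForm η) :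
    extD (θ + η) = extD θ + extD η := by
  funext x
  ext v
  simp only [extD, chartRep_add, extDeriv_add (hθ.differentiableAt x) (hη.differentiableAt x)]
  rfl

lemma extD_smul (c : ℝ) (θ : DForm m M F k) : extD (c • θ) = c • extD θ := by
  funext x
  ext v
  simp only [extD, chartRep_smul, extDeriv_smul]
  rfl

end Forms

/-- The space of closed smooth real `k`-forms. -/
def closedForms (m : ℕ) (M : Type*) [TopologicalSpace M]
    [ChartedSpace (EuclideanSpace ℝ (Fin m)) M] (k : ℕ) : Submodule ℝ (DForm m M ℝ k) where
  carrier := {θ | SmoothForm θ ∧ extD θ = 0}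
  zero_mem' := ⟨SmoothForm.zero, extD_zero⟩
  add_mem' := fun {a b} ha hb => ⟨ha.1.add hb.1, by
    rw [extD_add ha.1 hb.1, ha.2, hb.2, add_zero]⟩
  smul_mem' := fun c a ha => ⟨ha.1.smul c, by rw [extD_smul, ha.2, smul_zero]⟩

/-- The space of exact real `k`-forms: exterior derivatives of smooth `(k - 1)`-forms. -/
def exactForms (m : ℕ) (M : Type*) [TopologicalSpace M]
    [ChartedSpace (EuclideanSpace ℝ (Fin m)) M] : (k : ℕ) → Submodule ℝ (DForm m M ℝ k)
  | 0 => ⊥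
  | k + 1 =>
    { carrier := {θ | ∃ β : DForm m M ℝ k, SmoothForm β ∧ extD β = θ}
      zero_mem' := ⟨0, SmoothForm.zero, extD_zero⟩
      add_mem' := by
        rintro _ _ ⟨a, ha, rfl⟩ ⟨b, hb, rfl⟩
        exact ⟨a + b, ha.add hb, extD_add ha hb⟩
      smul_mem' := by
        rintro c _ ⟨a, ha, rfl⟩
        exact ⟨c • a, ha.smul c, extD_smul c a⟩ }

/-- The de Rham cohomology `H^k(M, ℝ)`: closed forms modulo exact forms. -/
abbrev DeRhamCohomology (m : ℕ) (M : Type*) [TopologicalSpace M]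
    [ChartedSpace (EuclideanSpace ℝ (Fin m)) M] (k : ℕ) :=
  closedForms m M k ⧸ (exactForms m M k).submoduleOf (closedForms m M k)

/-- The `k`-th Betti number `b_k(M) = dim H^k(M, ℝ)`, with the dimension taken as a cardinal, so
that no convention about infinite-dimensional spaces enters. -/
def bettiNumber (m : ℕ) (M : Type*) [TopologicalSpace M]
    [ChartedSpace (EuclideanSpace ℝ (Fin m)) M] (k : ℕ) : Cardinal :=
  Module.rank ℝ (DeRhamCohomology m M k)

/-! ### Vector fields, Lie derivatives and contractions of forms -/

section Fields

variable {m : ℕ} {M : Type*} [TopologicalSpace M] [ChartedSpace (EuclideanSpace ℝ (Fin m)) M]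
  [IsManifold (𝓡 m) ∞ M] {F : Type*} [NormedAddCommGroup F] [NormedSpace ℝ F] {k : ℕ}

/-- Smooth vector fields. -/
def SmoothVField (X : VField m M) : Prop :=
  ContMDiff (𝓡 m) (𝓡 m).tangent ∞ (fun x => (⟨x, X x⟩ : TangentBundle (𝓡 m) M))

/-- Vanishing of the Lie derivative `L_X γ`, through
`(L_X γ)(V₁, …, V_k) = X (γ(V₁, …, V_k)) - ∑ γ(V₁, …, [X, Vᵢ], …, V_k)`
for all smooth vector fields `V₁, …, V_k`. -/
def LieDerivEqZero (X : VField m M) (γ : DForm m M F k) : Prop :=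
  ∀ V : Fin k → VField m M, (∀ i, SmoothVField (V i)) → ∀ x : M,
    mvfderiv (𝓡 m) (fun y => γ y (fun i => V i y)) x (X x) -
      ∑ i, γ x (Function.update (fun j => V j x) i
        (VectorField.mlieBracket (𝓡 m) X (V i) x)) = 0

/-- Vanishing of the contraction `ι_X γ` (always true for functions). -/
def ContractionEqZero (X : VField m M) (γ : DForm m M F k) : Prop :=
  ∀ (x : M) (v : Fin k → TangentSpace (𝓡 m) x) (i : Fin k), v i = X x → γ x v = 0

end Fields

/-! ### Contact, Sasakian and contact Calabi–Yau structures in dimension `2n + 1` -/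

section Contact

variable {n : ℕ} {M : Type*} [TopologicalSpace M]
  [ChartedSpace (EuclideanSpace ℝ (Fin (2 * n + 1))) M] [IsManifold (𝓡 (2 * n + 1)) ∞ M]

/-- A contact form: a smooth `1`-form `α` such that `α ∧ (dα)ⁿ` vanishes nowhere. -/
structure IsContactForm (α : DForm (2 * n + 1) M ℝ 1) : Prop where
  smooth : SmoothForm α
  nondegenerate : ∀ x,
    wedge (α x).toAlternatingMap (wedgePow (extD α x).toAlternatingMap n) ≠ 0

/-- The contact distribution `ξ = ker α`. -/
def contactDist (α : DForm (2 * n + 1) M ℝ 1) (x : M) :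
    Set (TangentSpace (𝓡 (2 * n + 1)) x) :=
  {v | α x ![v] = 0}

/-- The Reeb vector field of a contact form: at each point, the (unique) vector `R` such that
`α(R) = 1` and `ι_R dα = 0`. -/
def reeb (α : DForm (2 * n + 1) M ℝ 1) : VField (2 * n + 1) M := fun x =>
  Classical.epsilon fun v => α x ![v] = 1 ∧ ∀ w, extD α x ![v, w] = 0

/-- The form `κ = ½ dα`. -/
def kappa (α : DForm (2 * n + 1) M ℝ 1) : DForm (2 * n + 1) M ℝ 2 := (1 / 2 : ℝ) • extD α

/-- `J` is a smooth complex structure on `ξ = ker α`, extended to `TM` by `J R = 0`, which is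
`κ`-calibrated: `g_J(v, w) = κ(v, J w)` is a `J`-Hermitian inner product on `ξ`. -/
structure IsCalibrated (α : DForm (2 * n + 1) M ℝ 1) (J : EndField (2 * n + 1) M) : Prop where
  smooth : ContMDiff (𝓡 (2 * n + 1))
    ((𝓡 (2 * n + 1)).prod 𝓘(ℝ, EuclideanSpace ℝ (Fin (2 * n + 1)) →L[ℝ]
      EuclideanSpace ℝ (Fin (2 * n + 1)))) ∞
    (fun x => TotalSpace.mk' (EuclideanSpace ℝ (Fin (2 * n + 1)) →L[ℝ]
        EuclideanSpace ℝ (Fin (2 * n + 1)))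
      (E := fun x : M => TangentSpace (𝓡 (2 * n + 1)) x →L[ℝ] TangentSpace (𝓡 (2 * n + 1)) x)
      x (J x))
  map_reeb : ∀ x, J x (reeb α x) = 0
  map_dist : ∀ x, ∀ v ∈ contactDist α x, J x v ∈ contactDist α x
  sq : ∀ x, ∀ v ∈ contactDist α x, J x (J x v) = -v
  symm : ∀ x, ∀ v ∈ contactDist α x, ∀ w ∈ contactDist α x,
    kappa α x ![v, J x w] = kappa α x ![w, J x v]
  pos : ∀ x, ∀ v ∈ contactDist α x, v ≠ 0 → 0 < kappa α x ![v, J x v]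
  hermitian : ∀ x, ∀ v ∈ contactDist α x, ∀ w ∈ contactDist α x,
    kappa α x ![J x v, J x (J x w)] = kappa α x ![v, J x w]

/-- The field of vectors `J X`. -/
def EndField.app (J : EndField (2 * n + 1) M) (X : VField (2 * n + 1) M) :
    VField (2 * n + 1) M := fun x => J x (X x)

/-- The Nijenhuis tensor
`N_J(X, Y) = [JX, JY] - J[X, JY] - J[JX, Y] + J²[X, Y]`. -/
def nijenhuis (J : EndField (2 * n + 1) M) (X Y : VField (2 * n + 1) M) :
    VField (2 * n + 1) M := fun x =>
  VectorField.mlieBracket (𝓡 (2 * n + 1)) (EndField.app J X) (EndField.app J Y) x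
    - J x (VectorField.mlieBracket (𝓡 (2 * n + 1)) X (EndField.app J Y) x)
    - J x (VectorField.mlieBracket (𝓡 (2 * n + 1)) (EndField.app J X) Y x)
    + J x (J x (VectorField.mlieBracket (𝓡 (2 * n + 1)) X Y x))

/-- `(α, J)` is a Sasakian structure: `α` is a contact form, `J` a `κ`-calibrated complex
structure on `ker α`, and `N_J = -dα ⊗ R`. -/
structure IsSasakian (α : DForm (2 * n + 1) M ℝ 1) (J : EndField (2 * n + 1) M) : Prop where
  contact : IsContactForm α
  calibrated : IsCalibrated α J
  integrable : ∀ X Y : VField (2 * n + 1) M, SmoothVField X → SmoothVField Y → ∀ x,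
    nijenhuis J X Y x = -(extD α x ![X x, Y x] • reeb α x)

/-- `(α, J, ε)` is a contact Calabi–Yau structure: `(α, J)` is Sasakian and `ε` is a nowhere
vanishing, closed, basic complex `n`-form, of type `(n, 0)` on `ξ` with respect to `J`, such that
`ε ∧ ε̄ = (-1)^{n(n+1)/2} (2i)ⁿ κⁿ`. -/
structure IsContactCalabiYau (α : DForm (2 * n + 1) M ℝ 1) (J : EndField (2 * n + 1) M)
    (ε : DForm (2 * n + 1) M ℂ n) : Prop where
  sasakian : IsSasakian α J
  smooth : SmoothForm ε
  ne_zero : ∀ x, ε x ≠ 0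
  basic_contraction : ContractionEqZero (reeb α) ε
  basic_lie : LieDerivEqZero (reeb α) ε
  type : ∀ (x : M) (v : Fin n → TangentSpace (𝓡 (2 * n + 1)) x),
    (∀ j, v j ∈ contactDist α x) → ∀ i,
      ε x (Function.update v i (J x (v i))) = Complex.I * ε x v
  volume : ∀ (x : M) (v : Fin (n + n) → TangentSpace (𝓡 (2 * n + 1)) x),
    wedge (ε x).toAlternatingMap
        (Complex.conjAe.toLinearMap.compAlternatingMap (ε x).toAlternatingMap) v =
      (-1) ^ (n * (n + 1) / 2) * (2 * Complex.I) ^ n *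
        (wedgePow (kappa α x).toAlternatingMap n (v ∘ Fin.cast (two_mul n)) : ℂ)
  closed : extD ε = 0

end Contact

/-- `M` admits a contact Calabi–Yau structure. -/
def AdmitsContactCalabiYau (n : ℕ) (M : Type*) [TopologicalSpace M]
    [ChartedSpace (EuclideanSpace ℝ (Fin (2 * n + 1))) M] [IsManifold (𝓡 (2 * n + 1)) ∞ M] :
    Prop :=
  ∃ (α : DForm (2 * n + 1) M ℝ 1) (J : EndField (2 * n + 1) M) (ε : DForm (2 * n + 1) M ℂ n),
    IsContactCalabiYau α J ε

end ContactCY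

end

/-!
The reason for the inequalities is that the transverse holomorphic volume form `ε`, and its product
`α ∧ ε` with the contact form, cannot be exact on a closed manifold.

Both forms are closed. For `α ∧ ε` this means `dα ∧ ε = 0`, which is a matter of type: `dα` is of
type `(1, 1)` and `ε` of type `(n, 0)`, so the product would have too many holomorphic directions
(`complexForm_wedge_eq_zero`; it rests on `IsHolType.eq_zero`, the vanishing of forms of type
`(p, 0)` with `2 p` greater than the dimension). The Reeb vector is in the kernel of `dα` and `ε`,
so these identities may be checked on the whole tangent space, with `J` extended by zero along it.

Suppose that `α ∧ (c₁ ε + c₂ ε̄) = dβ`. If `n ≥ 1`, then `ε̄ ∧ ε̄ = 0`, so that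
`d(β ∧ ε̄) = c₁ α ∧ ε ∧ ε̄`, which is `c₁` times a nonzero constant times `α ∧ κⁿ`
(`IsContactCalabiYau.wedge_volume`). As `α ∧ κⁿ` vanishes nowhere, whereas an exact form of top
degree on a closed manifold vanishes somewhere (`exists_extD_eq_zero`, a version of the theorem of
Stokes), `c₁ = 0`. If `c₁ ε + c₂ ε̄ = dβ`, then `d(β ∧ α ∧ ε̄)` gives `c₁ = 0` in the same way. A
real combination of the real and imaginary parts is of the form `c₁ z + c₂ z̄` with
`c₁ = (s - t i) / 2`, so the classes of these parts are linearly independent, in degree `n` for `ε`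
and in degree `n + 1` for `α ∧ ε`. For `n = 0` the argument with `c₂ = 0` remains, and yields a
nonzero class in degree `n + 1`.

Since `M` carries no orientation as part of its structure, the integrals in the proof of
`exists_extD_eq_zero` are taken chart by chart, with the orientation given by the nowhere vanishing
top degree form itself.
-/

noncomputable section

namespace ContactCY

/-! ### Algebra of the wedge product -/

section WedgeAlgebra

open AlternatingMap Equiv

variable {V A : Type*} [AddCommGroup V] [Module ℝ V] [CommRing A] [Algebra ℝ A] {k l p : ℕ}

/-- The exterior product of multilinear maps before antisymmetrisation: the first `k` arguments
are fed to `f`, the last `l` arguments to `g`. -/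
def tensorMul (f : MultilinearMap ℝ (fun _ : Fin k => V) A)
    (g : MultilinearMap ℝ (fun _ : Fin l => V) A) :
    MultilinearMap ℝ (fun _ : Fin (k + l) => V) A :=
  ((LinearMap.mul' ℝ A).compMultilinearMap (f.domCoprod g)).domDomCongr finSumFinEquiv

lemma tensorMul_apply (f : MultilinearMap ℝ (fun _ : Fin k => V) A)
    (g : MultilinearMap ℝ (fun _ : Fin l => V) A) (v : Fin (k + l) → V) :
    tensorMul f g v = f (fun i => v (Fin.castAdd l i)) * g (fun i => v (Fin.natAdd k i)) := by
  simp [tensorMul, MultilinearMap.domCoprod_apply]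

lemma alternatization_domDomCongr {ι ι' N : Type*} [Fintype ι] [DecidableEq ι] [Fintype ι']
    [DecidableEq ι'] [AddCommGroup N] [Module ℝ N] (e : ι ≃ ι')
    (f : MultilinearMap ℝ (fun _ : ι => V) N) :
    (f.domDomCongr e).alternatization = f.alternatization.domDomCongr e := by
  ext v
  simp only [MultilinearMap.alternatization_apply, MultilinearMap.domDomCongr_apply,
    AlternatingMap.domDomCongr_apply]
  refine Fintype.sum_equiv e.permCongr.symm _ _ fun σ => ?_
  simp

/-- The wedge product of antisymmetrised multilinear maps. Since every alternating map is, up to a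
factorial, the antisymmetrisation of itself, this reduces identities between wedge products to
identities between the simpler products `tensorMul`. -/
lemma wedge_alternatization (f : MultilinearMap ℝ (fun _ : Fin k => V) A)
    (g : MultilinearMap ℝ (fun _ : Fin l => V) A) :
    wedge f.alternatization g.alternatization = (tensorMul f g).alternatization := by
  rw [wedge, ← MultilinearMap.domCoprod_alternization,
    ← LinearMap.compMultilinearMap_alternatization, ← alternatization_domDomCongr]
  rfl

lemma wedge_add_left (a a' : V [⋀^Fin k]→ₗ[ℝ] A) (b : V [⋀^Fin l]→ₗ[ℝ] A) :
    wedge (a + a') b = wedge a b + wedge a' b := by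
  ext v
  simp only [wedge, ← AlternatingMap.domCoprod'_apply, TensorProduct.add_tmul, map_add]
  simp

lemma wedge_add_right (a : V [⋀^Fin k]→ₗ[ℝ] A) (b b' : V [⋀^Fin l]→ₗ[ℝ] A) :
    wedge a (b + b') = wedge a b + wedge a b' := by
  ext v
  simp only [wedge, ← AlternatingMap.domCoprod'_apply, TensorProduct.tmul_add, map_add]
  simp

lemma wedge_smul_left (c : ℝ) (a : V [⋀^Fin k]→ₗ[ℝ] A) (b : V [⋀^Fin l]→ₗ[ℝ] A) :
    wedge (c • a) b = c • wedge a b := by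
  ext v
  simp only [wedge, ← AlternatingMap.domCoprod'_apply, ← TensorProduct.smul_tmul', map_smul]
  simp

lemma wedge_smul_right (c : ℝ) (a : V [⋀^Fin k]→ₗ[ℝ] A) (b : V [⋀^Fin l]→ₗ[ℝ] A) :
    wedge a (c • b) = c • wedge a b := by
  ext v
  simp only [wedge, ← AlternatingMap.domCoprod'_apply, TensorProduct.tmul_smul, map_smul]
  simp

lemma factorial_smul_wedge (a : V [⋀^Fin k]→ₗ[ℝ] A) (b : V [⋀^Fin l]→ₗ[ℝ] A) :
    ((k.factorial : ℝ) * l.factorial) • wedge a b =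
      (tensorMul a.toMultilinearMap b.toMultilinearMap).alternatization := by
  rw [← wedge_alternatization, coe_alternatization, coe_alternatization,
    ← Nat.cast_smul_eq_nsmul ℝ, ← Nat.cast_smul_eq_nsmul ℝ, wedge_smul_left, wedge_smul_right,
    Fintype.card_fin, Fintype.card_fin, mul_smul]

lemma factorial_mul_ne_zero (k l : ℕ) : ((k.factorial : ℝ) * l.factorial) ≠ 0 := by positivity

/-- The explicit formula for the wedge product, as a sum over all permutations. -/
lemma wedge_apply (a : V [⋀^Fin k]→ₗ[ℝ] A) (b : V [⋀^Fin l]→ₗ[ℝ] A) (v : Fin (k + l) → V) :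
    wedge a b v = ((k.factorial : ℝ) * l.factorial)⁻¹ • ∑ σ : Perm (Fin (k + l)), Perm.sign σ •
      (a (fun i => v (σ (Fin.castAdd l i))) * b (fun i => v (σ (Fin.natAdd k i)))) := by
  have h := congrArg (fun f => f v) (factorial_smul_wedge a b)
  simp only [AlternatingMap.smul_apply, MultilinearMap.alternatization_apply,
    MultilinearMap.domDomCongr_apply, tensorMul_apply] at h
  rw [eq_inv_smul_iff₀ (factorial_mul_ne_zero k l)]
  exact h

lemma wedge_comp {W : Type*} [AddCommGroup W] [Module ℝ W] (f : W →ₗ[ℝ] V)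
    (a : V [⋀^Fin k]→ₗ[ℝ] A) (b : V [⋀^Fin l]→ₗ[ℝ] A) :
    wedge (a.compLinearMap f) (b.compLinearMap f) = (wedge a b).compLinearMap f := by
  ext v
  simp [wedge_apply]

/-- The wedge product is compatible with a homomorphism of coefficient algebras. -/
lemma wedge_map {B : Type*} [CommRing B] [Algebra ℝ B] (φ : A →ₐ[ℝ] B)
    (a : V [⋀^Fin k]→ₗ[ℝ] A) (b : V [⋀^Fin l]→ₗ[ℝ] A) :
    wedge (φ.toLinearMap.compAlternatingMap a) (φ.toLinearMap.compAlternatingMap b) =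
      φ.toLinearMap.compAlternatingMap (wedge a b) := by
  ext v
  simp [wedge_apply, Units.smul_def]

lemma wedge_assoc (a : V [⋀^Fin k]→ₗ[ℝ] A) (b : V [⋀^Fin l]→ₗ[ℝ] A)
    (c : V [⋀^Fin p]→ₗ[ℝ] A) (v : Fin (k + (l + p)) → V) :
    wedge (wedge a b) c (v ∘ Fin.cast (add_assoc k l p)) = wedge a (wedge b c) v := by
  -- For antisymmetrisations the claim is associativity of `tensorMul`; the general case differs
  -- from this one by factorials, which cancel.
  have key : ∀ (a : MultilinearMap ℝ (fun _ : Fin k => V) A)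
      (b : MultilinearMap ℝ (fun _ : Fin l => V) A) (c : MultilinearMap ℝ (fun _ : Fin p => V) A),
      wedge (wedge a.alternatization b.alternatization) c.alternatization
        (v ∘ Fin.cast (add_assoc k l p)) =
      wedge a.alternatization (wedge b.alternatization c.alternatization) v := by
    intro a b c
    simp only [wedge_alternatization]
    have : tensorMul a (tensorMul b c) =
        (tensorMul (tensorMul a b) c).domDomCongr (finCongr (add_assoc k l p)) := by
      ext v
      simp only [tensorMul_apply, MultilinearMap.domDomCongr_apply, ← mul_assoc]
      congr!; exact Fin.ext (by simp [add_assoc])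
    rw [this, alternatization_domDomCongr]
    rfl
  have h := key a.toMultilinearMap b.toMultilinearMap c.toMultilinearMap
  simp only [coe_alternatization, ← Nat.cast_smul_eq_nsmul ℝ, wedge_smul_left,
    wedge_smul_right, AlternatingMap.smul_apply, smul_smul, Fintype.card_fin, mul_assoc] at h
  exact smul_right_injective A (r := ((p.factorial : ℝ) * (l.factorial * k.factorial)))
    (by positivity) h

variable (V A k l) in
/-- Graded commutativity of the wedge product; only the fact that the sign depends on nothing but
the degrees is recorded. -/
lemma wedge_comm : ∃ s : ℤˣ, ∀ (a : V [⋀^Fin k]→ₗ[ℝ] A) (b : V [⋀^Fin l]→ₗ[ℝ] A)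
    (v : Fin (k + l) → V), wedge a b v = s • wedge b a (v ∘ Fin.cast (add_comm l k)) := by
  -- `e` exchanges the two blocks of indices; the sign is that of `e` as a permutation.
  let e : Fin (l + k) ≃ Fin (k + l) :=
    finSumFinEquiv.symm.trans ((Equiv.sumComm _ _).trans finSumFinEquiv)
  let c : Fin (l + k) ≃ Fin (k + l) := finCongr (add_comm l k)
  refine ⟨Perm.sign (e.trans c.symm), fun a b v => ?_⟩
  have h1 : wedge b a (v ∘ e) = wedge a b v := by
    rw [wedge_apply, wedge_apply, mul_comm]
    congr 1
    refine Fintype.sum_equiv e.permCongr _ _ fun σ => ?_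
    rw [Perm.sign_permCongr, mul_comm (b _)]
    simp [e]
  have h2 : v ∘ e = (v ∘ c) ∘ (e.trans c.symm) := by ext i; simp
  rw [← h1, h2, AlternatingMap.map_perm]
  rfl

@[simp]
lemma zero_wedge (b : V [⋀^Fin l]→ₗ[ℝ] A) : wedge (0 : V [⋀^Fin k]→ₗ[ℝ] A) b = 0 := by
  simpa using wedge_smul_left (0 : ℝ) (0 : V [⋀^Fin k]→ₗ[ℝ] A) b

/-- Wedge products are not affected by an identification of degrees which are equal only
propositionally, such as `k + l` and `l + k`; these identifications are spelled out as reindexings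
of the arguments by `Fin.cast`. -/
lemma wedge_cast_left {k' : ℕ} (h : k = k') (a : V [⋀^Fin k]→ₗ[ℝ] A)
    (a' : V [⋀^Fin k']→ₗ[ℝ] A) (ha : ∀ v, a' v = a (v ∘ Fin.cast h)) (b : V [⋀^Fin l]→ₗ[ℝ] A)
    (v : Fin (k' + l) → V) :
    wedge a' b v = wedge a b (v ∘ Fin.cast (congrArg (· + l) h)) := by
  subst h
  obtain rfl : a' = a := by ext v; exact ha v
  rfl

lemma wedge_cast_right {l' : ℕ} (h : l = l') (a : V [⋀^Fin k]→ₗ[ℝ] A)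
    (b : V [⋀^Fin l]→ₗ[ℝ] A) (b' : V [⋀^Fin l']→ₗ[ℝ] A) (hb : ∀ v, b' v = b (v ∘ Fin.cast h))
    (v : Fin (k + l') → V) :
    wedge a b' v = wedge a b (v ∘ Fin.cast (congrArg (k + ·) h)) := by
  subst h
  obtain rfl : b' = b := by ext v; exact hb v
  rfl

/-- Antisymmetrising all arguments of a multilinear map amounts to antisymmetrising the last `k`
of them, and then the first one against the others. -/
lemma alternatizeUncurryFin_alternatization {N : Type*} [AddCommGroup N] [Module ℝ N]
    (D : V →ₗ[ℝ] V [⋀^Fin k]→ₗ[ℝ] N)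
    (G : V →ₗ[ℝ] MultilinearMap ℝ (fun _ : Fin k => V) N)
    (hG : ∀ v, D v = (G v).alternatization) :
    alternatizeUncurryFin D = (G.uncurryLeft).alternatization := by
  ext v
  rw [alternatizeUncurryFin_apply, MultilinearMap.alternatization_apply]
  simp only [hG, MultilinearMap.alternatization_apply, MultilinearMap.domDomCongr_apply,
    LinearMap.uncurryLeft_apply, Finset.smul_sum]
  rw [← Fintype.sum_prod_type']
  -- A permutation of `Fin (k + 1)` amounts to the image of `0` and a permutation of the others.
  let f : Fin (k + 1) × Perm (Fin k) → Perm (Fin (k + 1)) := fun x =>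
    (Fin.cycleRange x.1).symm * Perm.decomposeFin.symm (0, x.2)
  have f0 : ∀ x, f x 0 = x.1 := fun x => by
    simp [f]
  have fs : ∀ x j, f x (Fin.succ j) = x.1.succAbove (x.2 j) := fun x j => by
    simp [f]
  have hf : Function.Bijective f := by
    rw [Fintype.bijective_iff_injective_and_card]
    constructor
    · intro x y hxy
      have h1 : x.1 = y.1 := by rw [← f0, ← f0, hxy]
      refine Prod.ext h1 (Equiv.ext fun j => ?_)
      have := fs x j
      rw [hxy, fs, h1] at this
      exact (Fin.succAbove_right_injective this).symm
    · simp [Fintype.card_perm, Nat.factorial_succ]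
  refine Fintype.sum_bijective f hf _ _ fun x => ?_
  have hs : Perm.sign (f x) = (-1) ^ (x.1 : ℕ) * Perm.sign x.2 := by
    simp only [f, map_mul, Perm.decomposeFin.symm_sign, if_pos, one_mul]
    congr 1
    rw [Perm.sign_symm, Fin.sign_cycleRange]
  rw [hs, f0, mul_smul]
  simp only [Fin.tail_def, fs, Fin.removeNth_apply, Units.smul_def]
  simp

lemma alternatizeUncurryFin_cast {N : Type*} [AddCommGroup N] [Module ℝ N] (h : k = l)
    (D : V →ₗ[ℝ] V [⋀^Fin k]→ₗ[ℝ] N) (D' : V →ₗ[ℝ] V [⋀^Fin l]→ₗ[ℝ] N)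
    (hD : ∀ x v, D' x v = D x (v ∘ Fin.cast h)) (v : Fin (l + 1) → V) :
    alternatizeUncurryFin D' v =
      alternatizeUncurryFin D (v ∘ Fin.cast (congrArg (· + 1) h)) := by
  subst h
  obtain rfl : D' = D := by ext x v; exact hD x v
  rfl

/-- Wedging with a fixed form commutes with antisymmetrisation of one more argument. This one
identity yields the Leibniz rule and the vanishing of `(1, 1)`-forms wedged with `(n, 0)`-forms. -/
lemma alternatizeUncurryFin_wedge (D : V →ₗ[ℝ] V [⋀^Fin k]→ₗ[ℝ] A) (b : V [⋀^Fin l]→ₗ[ℝ] A)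
    (D' : V →ₗ[ℝ] V [⋀^Fin (k + l)]→ₗ[ℝ] A) (hD' : ∀ v, D' v = wedge (D v) b)
    (v : Fin (k + l + 1) → V) :
    alternatizeUncurryFin D' v =
      wedge (alternatizeUncurryFin D) b (v ∘ Fin.cast (Nat.add_right_comm k 1 l)) := by
  -- `k! • D` and `k! l! • D'` are antisymmetrisations of the multilinear maps `G` and `G'`.
  let G : V →ₗ[ℝ] MultilinearMap ℝ (fun _ : Fin k => V) A :=
    AlternatingMap.toMultilinearMapLM (S := ℝ) ∘ₗ D
  let G' : V →ₗ[ℝ] MultilinearMap ℝ (fun _ : Fin (k + l) => V) A :=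
    { toFun := fun v => tensorMul (G v) b.toMultilinearMap
      map_add' := fun v w => by ext u; simp [tensorMul_apply, add_mul]
      map_smul' := fun v w => by ext u; simp [tensorMul_apply] }
  have h1 := alternatizeUncurryFin_alternatization ((k.factorial : ℝ) • D) G fun v => by
    have := coe_alternatization (D v)
    rw [Fintype.card_fin, ← Nat.cast_smul_eq_nsmul ℝ] at this
    exact this.symm
  have h2 := alternatizeUncurryFin_alternatization (((k.factorial : ℝ) * l.factorial) • D') G'
    fun v => by
      rw [LinearMap.smul_apply, hD', factorial_smul_wedge]; rfl
  rw [alternatizeUncurryFin_smul] at h1 h2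
  have h3 := wedge_alternatization G.uncurryLeft b.toMultilinearMap
  rw [coe_alternatization, Fintype.card_fin, ← Nat.cast_smul_eq_nsmul ℝ, ← h1, wedge_smul_left,
    wedge_smul_right, smul_smul] at h3
  have h4 : G'.uncurryLeft = (tensorMul G.uncurryLeft b.toMultilinearMap).domDomCongr
      (finCongr (Nat.add_right_comm k 1 l)) := by
    ext u
    simp only [tensorMul_apply, MultilinearMap.domDomCongr_apply, LinearMap.uncurryLeft_apply]
    change tensorMul (G (u 0)) b.toMultilinearMap (Fin.tail u) = _
    rw [tensorMul_apply]
    congr! 1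
    congr 1
    ext i
    exact congrArg u (Fin.ext (by simp [add_right_comm]))
  rw [h4, alternatization_domDomCongr, ← h3] at h2
  have h5 := congrArg (fun f => f v) h2
  exact smul_right_injective A (factorial_mul_ne_zero k l) h5

end WedgeAlgebra

/-! ### Forms of type `(p, 0)` and the Reeb vector -/

section PointwiseAlgebra

open AlternatingMap Function Module

variable {V : Type*} [AddCommGroup V] [Module ℝ V] {k l p : ℕ}

/-- A complex valued alternating form is of type `(p, 0)` with respect to an endomorphism `J` if
it is complex linear in each argument, `J` acting as multiplication by `i`. Vectors killed by `J`
are then killed by the form. -/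
def IsHolType (J : V →ₗ[ℝ] V) (η : V [⋀^Fin p]→ₗ[ℝ] ℂ) : Prop :=
  ∀ (v : Fin p → V) (i : Fin p), η (update v i (J (v i))) = Complex.I * η v

/-- Forms of type `(p, 0)` vanish as soon as `2 p > dim V`: the vectors `v₁, …, v_p` and
`J v₁, …, J v_p` are linearly dependent, and a relation with a nonzero coefficient at `v_k` or
`J v_k` expresses a nonzero complex multiple of `η v` by values of `η` at tuples with a
repetition. -/
lemma IsHolType.eq_zero [FiniteDimensional ℝ V] {J : V →ₗ[ℝ] V} {η : V [⋀^Fin p]→ₗ[ℝ] ℂ}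
    (hη : IsHolType J η) (hp : finrank ℝ V < 2 * p) : η = 0 := by
  ext v
  have hdep : ¬ LinearIndependent ℝ (Sum.elim v (J ∘ v)) := fun h => by
    have := h.fintype_card_le_finrank
    simp only [Fintype.card_sum, Fintype.card_fin] at this
    omega
  obtain ⟨g, hg, i, hi⟩ := Fintype.not_linearIndependent_iff.1 hdep
  simp only [Fintype.sum_sum_type, Sum.elim_inl, Sum.elim_inr, comp_apply] at hg
  obtain ⟨j, hj⟩ : ∃ j, (g (Sum.inl j) : ℂ) + g (Sum.inr j) * Complex.I ≠ 0 := by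
    by_contra! h
    rcases i with i | i
    · exact hi (by simpa using congrArg Complex.re (h i))
    · exact hi (by simpa using congrArg Complex.im (h i))
  have hval : ∀ i, g (Sum.inl i) • η (update v j (v i)) + g (Sum.inr i) • η (update v j (J (v i)))
      = if i = j then ((g (Sum.inl j) : ℂ) + g (Sum.inr j) * Complex.I) * η v else 0 := by
    intro i
    have hJ : η (update v j (J (v i))) = Complex.I * η (update v j (v i)) := by
      simpa using hη (update v j (v i)) j
    rw [hJ]
    split_ifs with h
    · subst h
      simp only [update_eq_self, Complex.real_smul]
      ring
    · rw [η.map_update_self v (Ne.symm h)]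
      simp
  have h0 : ∑ i, (g (Sum.inl i) • η (update v j (v i)) +
      g (Sum.inr i) • η (update v j (J (v i)))) = 0 := by
    have := congrArg (fun x => η (update v j x)) hg
    simp only [← Finset.sum_add_distrib] at this
    rw [AlternatingMap.map_update_zero, AlternatingMap.map_update_sum] at this
    simpa [AlternatingMap.map_update_add, AlternatingMap.map_update_smul] using this
  simp only [hval, Finset.sum_ite_eq', Finset.mem_univ, if_true] at h0
  simpa [hj] using h0

lemma IsHolType.wedge {J : V →ₗ[ℝ] V} {a : V [⋀^Fin k]→ₗ[ℝ] ℂ} {b : V [⋀^Fin l]→ₗ[ℝ] ℂ}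
    (ha : IsHolType J a) (hb : IsHolType J b) : IsHolType J (ContactCY.wedge a b) := by
  intro v i
  rw [wedge_apply, wedge_apply, mul_smul_comm, Finset.mul_sum]
  congr 1
  refine Finset.sum_congr rfl fun σ _ => ?_
  rw [mul_smul_comm]
  congr 1
  obtain ⟨j, rfl⟩ := σ.surjective i
  induction j using Fin.addCases with
  | left j =>
    have h1 : (fun i => update v (σ (Fin.castAdd l j)) (J (v (σ (Fin.castAdd l j))))
        (σ (Fin.castAdd l i))) = update (fun i => v (σ (Fin.castAdd l i))) j
          (J (v (σ (Fin.castAdd l j)))) := by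
      ext1 i
      simp [update_apply]
    have h2 : (fun i => update v (σ (Fin.castAdd l j)) (J (v (σ (Fin.castAdd l j))))
        (σ (Fin.natAdd k i))) = (fun i => v (σ (Fin.natAdd k i))) := by
      ext1 i
      simp [update_apply, Fin.ext_iff]
      intro h
      omega
    rw [h1, h2, ha (fun i => v (σ (Fin.castAdd l i))) j, mul_assoc]
  | right j =>
    have h1 : (fun i => update v (σ (Fin.natAdd k j)) (J (v (σ (Fin.natAdd k j))))
        (σ (Fin.natAdd k i))) = update (fun i => v (σ (Fin.natAdd k i))) j
          (J (v (σ (Fin.natAdd k j)))) := by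
      ext1 i
      simp [update_apply]
    have h2 : (fun i => update v (σ (Fin.natAdd k j)) (J (v (σ (Fin.natAdd k j))))
        (σ (Fin.castAdd l i))) = (fun i => v (σ (Fin.castAdd l i))) := by
      ext1 i
      simp [update_apply, Fin.ext_iff]
      intro h
      omega
    rw [h1, h2, hb (fun i => v (σ (Fin.natAdd k i))) j, mul_left_comm]

/-- The complex conjugate of a complex valued alternating form. -/
def conjForm (η : V [⋀^Fin p]→ₗ[ℝ] ℂ) : V [⋀^Fin p]→ₗ[ℝ] ℂ :=
  Complex.conjAe.toLinearMap.compAlternatingMap η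

/-- A real alternating form regarded as a complex valued one. -/
def complexForm (θ : V [⋀^Fin p]→ₗ[ℝ] ℝ) : V [⋀^Fin p]→ₗ[ℝ] ℂ :=
  Complex.ofRealAm.toLinearMap.compAlternatingMap θ

@[simp]
lemma conjForm_apply (η : V [⋀^Fin p]→ₗ[ℝ] ℂ) (v : Fin p → V) :
    conjForm η v = starRingEnd ℂ (η v) := rfl

@[simp]
lemma complexForm_apply (θ : V [⋀^Fin p]→ₗ[ℝ] ℝ) (v : Fin p → V) :
    complexForm θ v = (θ v : ℂ) := rfl

lemma conjForm_complexForm (θ : V [⋀^Fin p]→ₗ[ℝ] ℝ) :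
    conjForm (complexForm θ) = complexForm θ := by
  ext v; simp

lemma conjForm_wedge (a : V [⋀^Fin k]→ₗ[ℝ] ℂ) (b : V [⋀^Fin l]→ₗ[ℝ] ℂ) :
    wedge (conjForm a) (conjForm b) = conjForm (wedge a b) :=
  wedge_map (Complex.conjAe : ℂ →ₐ[ℝ] ℂ) a b

lemma complexForm_wedge (a : V [⋀^Fin k]→ₗ[ℝ] ℝ) (b : V [⋀^Fin l]→ₗ[ℝ] ℝ) :
    wedge (complexForm a) (complexForm b) = complexForm (wedge a b) :=
  wedge_map Complex.ofRealAm a b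

/-- A form killed by `R` does not change when its arguments are projected along `R`. -/
lemma map_projection_eq {N : Type*} [AddCommGroup N] [Module ℝ N] (η : V [⋀^Fin p]→ₗ[ℝ] N)
    (R : V) (hR : ∀ (v : Fin p → V) (i : Fin p), v i = R → η v = 0) (c : V → ℝ) (v : Fin p → V) :
    η (fun i => v i - c (v i) • R) = η v := by
  have key : ∀ s : Finset (Fin p), η (s.piecewise (fun i => v i - c (v i) • R) v) = η v := by
    intro s
    induction s using Finset.induction_on with
    | empty => simp
    | insert i s hi ih =>
      rw [Finset.piecewise_insert, AlternatingMap.map_update_sub, AlternatingMap.map_update_smul,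
        hR (update _ i R) i (by simp), smul_zero, sub_zero]
      rw [← ih]
      congr 1
      rw [update_eq_self_iff, Finset.piecewise_eq_of_notMem _ _ _ hi]
  simpa using key Finset.univ

/-- The bilinear form underlying an alternating `2`-form. -/
def toBilin (θ : V [⋀^Fin 2]→ₗ[ℝ] ℝ) : V →ₗ[ℝ] V →ₗ[ℝ] ℝ :=
  LinearMap.mk₂ ℝ (fun v w => θ ![v, w])
    (fun v v' w => θ.map_vecCons_add ![w] v v')
    (fun c v w => θ.map_vecCons_smul ![w] c v)
    (fun v w w' => by
      have e : ∀ x, update ![v, 0] 1 x = ![v, x] := fun x => by ext i; fin_cases i <;> rfl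
      simpa only [e] using θ.map_update_add ![v, 0] 1 w w')
    (fun c v w => by
      have e : ∀ x, update ![v, 0] 1 x = ![v, x] := fun x => by ext i; fin_cases i <;> rfl
      simpa only [e] using θ.map_update_smul ![v, 0] 1 c w)

lemma toBilin_apply (θ : V [⋀^Fin 2]→ₗ[ℝ] ℝ) (v w : V) : toBilin θ v w = θ ![v, w] := rfl

lemma toBilin_swap (θ : V [⋀^Fin 2]→ₗ[ℝ] ℝ) (v w : V) : toBilin θ w v = -toBilin θ v w := by
  have := θ.map_swap ![v, w] (i := 0) (j := 1) (by simp)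
  rw [toBilin_apply, toBilin_apply, ← this]
  congr 1
  ext i
  fin_cases i <;> rfl

/-- A real `2`-form of type `(1, 1)` wedged with an `(n, 0)`-form vanishes if `2 (n + 1)` exceeds
the dimension: the `2`-form is the antisymmetrisation of a form `H (v, w)` which is complex linear
in `w`, and `H (v, ·) ∧ ε` is of type `(n + 1, 0)`. -/
lemma complexForm_wedge_eq_zero [FiniteDimensional ℝ V] {J : V →ₗ[ℝ] V} (θ : V [⋀^Fin 2]→ₗ[ℝ] ℝ)
    (hJJ : ∀ v w, θ ![v, J (J w)] = -θ ![v, w]) (hsymm : ∀ v w, θ ![v, J w] = θ ![w, J v])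
    {ε : V [⋀^Fin p]→ₗ[ℝ] ℂ} (hε : IsHolType J ε) (hp : finrank ℝ V < 2 * (p + 1)) :
    wedge (complexForm θ) ε = 0 := by
  let ofReal : ℝ →ₗ[ℝ] ℂ := Complex.ofRealAm.toLinearMap
  -- `H (v, w) = θ (v, w) - i θ (v, J w)`; the second term is symmetric in `v` and `w`, so that
  -- antisymmetrisation only leaves `2 θ`.
  let H : V →ₗ[ℝ] V [⋀^Fin 1]→ₗ[ℝ] ℂ :=
    { toFun := fun v => ofSubsingleton ℝ V ℂ (0 : Fin 1)
        (ofReal ∘ₗ toBilin θ v - Complex.I • (ofReal ∘ₗ toBilin θ v ∘ₗ J))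
      map_add' := fun v w => by ext u; simp; ring
      map_smul' := fun c v => by ext u; simp [ofReal]; ring }
  have H_apply : ∀ v u, H v u = θ ![v, u 0] - Complex.I * θ ![v, J (u 0)] := fun v u => rfl
  have hH : ∀ v, IsHolType J (H v) := by
    intro v u i
    obtain rfl : i = 0 := Subsingleton.elim _ _
    rw [H_apply, H_apply, update_self, hJJ]
    push_cast
    ring_nf
    rw [Complex.I_sq]
    ring
  have hz : ∀ v, (0 : V →ₗ[ℝ] V [⋀^Fin (1 + p)]→ₗ[ℝ] ℂ) v = wedge (H v) ε := fun v =>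
    (((hH v).wedge hε).eq_zero (by omega)).symm
  have hH2 : alternatizeUncurryFin H = (2 : ℝ) • complexForm θ := by
    ext u
    rw [alternatizeUncurryFin_apply]
    refine (Fin.sum_univ_two _).trans ?_
    simp only [H_apply]
    have e1 : θ ![u 1, u 0] = - θ ![u 0, u 1] := toBilin_swap θ _ _
    have e2 : ![u 0, u 1] = u := by ext i; fin_cases i <;> rfl
    have e3 : Fin.removeNth (0 : Fin 2) u 0 = u 1 := rfl
    have e4 : Fin.removeNth (1 : Fin 2) u 0 = u 0 := rfl
    simp only [e3, e4, e1, hsymm (u 1) (u 0), e2]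
    simp
    ring
  have key := fun v : Fin (2 + p) → V =>
    alternatizeUncurryFin_wedge H ε 0 hz (v ∘ Fin.cast (by omega))
  rw [hH2, wedge_smul_left] at key
  have h0 : alternatizeUncurryFin (0 : V →ₗ[ℝ] V [⋀^Fin (1 + p)]→ₗ[ℝ] ℂ) = 0 := by
    ext u; simp [alternatizeUncurryFin_apply]
  ext v
  have := key v
  rw [h0] at this
  have h2 : (2 : ℝ) • wedge (complexForm θ) ε v = 0 := this.symm
  simpa using h2

/-- Existence of the Reeb vector: for a nonzero covector `α` and a `2`-form `θ` which is
nondegenerate on `ker α`, the map `v ↦ θ (v, ·)` to the dual of `ker α` has a kernel for dimension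
reasons, and this kernel is transverse to `ker α`. -/
lemma exists_reeb_vector [FiniteDimensional ℝ V] (α : V →ₗ[ℝ] ℝ) (hα : α ≠ 0)
    (θ : V [⋀^Fin 2]→ₗ[ℝ] ℝ) (J : V → V) (hJ : ∀ v, α v = 0 → α (J v) = 0)
    (hpos : ∀ v, α v = 0 → v ≠ 0 → 0 < θ ![v, J v]) :
    ∃ R, α R = 1 ∧ ∀ w, θ ![R, w] = 0 := by
  let K := LinearMap.ker α
  let L : V →ₗ[ℝ] Dual ℝ K := K.subtype.dualMap ∘ₗ toBilin θ
  have hL : LinearMap.ker L ≠ ⊥ := by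
    apply LinearMap.ker_ne_bot_of_finrank_lt
    rw [Subspace.dual_finrank_eq]
    refine Submodule.finrank_lt fun h => hα ?_
    exact LinearMap.ker_eq_top.1 h
  obtain ⟨r, hr, hr0⟩ := (Submodule.ne_bot_iff _).1 hL
  have hr' : ∀ w, α w = 0 → θ ![r, w] = 0 := fun w hw =>
    congrArg (fun f => f (⟨w, hw⟩ : K)) (LinearMap.mem_ker.1 hr)
  have hαr : α r ≠ 0 := fun h => (hpos r h hr0).ne' (hr' _ (hJ r h))
  refine ⟨(α r)⁻¹ • r, by simp [hαr], fun w => ?_⟩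
  have h1 : toBilin θ r r = 0 := by
    have := toBilin_swap θ r r
    linarith
  have h2 : toBilin θ r (w - (α w * (α r)⁻¹) • r) = 0 := hr' _ (by simp [hαr])
  rw [map_sub, map_smul, h1, smul_zero, sub_zero] at h2
  change toBilin θ ((α r)⁻¹ • r) w = 0
  rw [map_smul, LinearMap.smul_apply, h2, smul_zero]

lemma wedgePow_smul (c : ℝ) (θ : V [⋀^Fin 2]→ₗ[ℝ] ℝ) (q : ℕ) :
    wedgePow (c • θ) q = c ^ q • wedgePow θ q := by
  induction q with
  | zero => simp [wedgePow]
  | succ q ih => rw [wedgePow, wedgePow, ih, wedge_smul_left, wedge_smul_right, smul_smul, pow_succ]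

end PointwiseAlgebra

/-! ### Continuous wedge product and the Leibniz rule -/

section ContinuousWedge

variable {V : Type*} [AddCommGroup V] [Module ℝ V] [TopologicalSpace V] {k l : ℕ}

/-- The wedge product of continuous complex valued alternating maps. -/
def cwedge (a : V [⋀^Fin k]→L[ℝ] ℂ) (b : V [⋀^Fin l]→L[ℝ] ℂ) : V [⋀^Fin (k + l)]→L[ℝ] ℂ where
  toAlternatingMap := wedge a.toAlternatingMap b.toAlternatingMap
  cont := by
    change Continuous fun v => wedge a.toAlternatingMap b.toAlternatingMap v
    simp only [wedge_apply, ContinuousAlternatingMap.coe_toAlternatingMap]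
    refine Continuous.comp (continuous_const_smul _) (continuous_finsetSum _ fun σ _ => ?_)
    refine Continuous.comp (continuous_const_smul _) (Continuous.mul ?_ ?_)
    · exact a.cont.comp (by fun_prop)
    · exact b.cont.comp (by fun_prop)

lemma cwedge_apply (a : V [⋀^Fin k]→L[ℝ] ℂ) (b : V [⋀^Fin l]→L[ℝ] ℂ) (v : Fin (k + l) → V) :
    cwedge a b v = wedge a.toAlternatingMap b.toAlternatingMap v := rfl

lemma cwedge_comp {W : Type*} [AddCommGroup W] [Module ℝ W] [TopologicalSpace W] (f : W →L[ℝ] V)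
    (a : V [⋀^Fin k]→L[ℝ] ℂ) (b : V [⋀^Fin l]→L[ℝ] ℂ) :
    cwedge (a.compContinuousLinearMap f) (b.compContinuousLinearMap f) =
      (cwedge a b).compContinuousLinearMap f := by
  ext v
  exact congrArg (fun g => g v) (wedge_comp f.toLinearMap a.toAlternatingMap b.toAlternatingMap)

end ContinuousWedge

section Leibniz

variable {E : Type*} [NormedAddCommGroup E] [NormedSpace ℝ E] {k l : ℕ}

lemma norm_cwedge_le (a : E [⋀^Fin k]→L[ℝ] ℂ) (b : E [⋀^Fin l]→L[ℝ] ℂ) :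
    ‖cwedge a b‖ ≤ ((k.factorial : ℝ) * l.factorial)⁻¹ * (k + l).factorial * ‖a‖ * ‖b‖ := by
  refine ContinuousAlternatingMap.opNorm_le_bound _ (by positivity) fun v => ?_
  rw [cwedge_apply, wedge_apply, norm_smul, Real.norm_of_nonneg (by positivity)]
  simp only [mul_assoc]
  refine mul_le_mul_of_nonneg_left ?_ (by positivity)
  refine (norm_sum_le _ _).trans ?_
  have hterm : ∀ σ : Equiv.Perm (Fin (k + l)),
      ‖Equiv.Perm.sign σ • (a (fun i => v (σ (Fin.castAdd l i))) *
        b (fun i => v (σ (Fin.natAdd k i))))‖ ≤ ‖a‖ * (‖b‖ * ∏ i, ‖v i‖) := by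
    intro σ
    have h1 : ∀ z : ℂ, ‖Equiv.Perm.sign σ • z‖ = ‖z‖ := fun z => by
      rcases Int.units_eq_one_or (Equiv.Perm.sign σ) with h | h <;> simp [h]
    have h2 : ∏ i, ‖v i‖ = (∏ i, ‖v (σ (Fin.castAdd l i))‖) * ∏ i, ‖v (σ (Fin.natAdd k i))‖ := by
      rw [← Fin.prod_univ_add (fun i => ‖v (σ i)‖), Equiv.prod_comp σ (fun i => ‖v i‖)]
    rw [h1, norm_mul, h2]
    refine (mul_le_mul (a.le_opNorm _) (b.le_opNorm _) (norm_nonneg _) (by positivity)).trans ?_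
    exact le_of_eq (by ring)
  refine (Finset.sum_le_sum fun σ _ => hterm σ).trans ?_
  rw [Finset.sum_const, Finset.card_univ, Fintype.card_perm, Fintype.card_fin, nsmul_eq_mul]

variable (E k l) in
/-- The wedge product as a continuous bilinear map. -/
def cwedgeL : (E [⋀^Fin k]→L[ℝ] ℂ) →L[ℝ] (E [⋀^Fin l]→L[ℝ] ℂ) →L[ℝ] E [⋀^Fin (k + l)]→L[ℝ] ℂ :=
  LinearMap.mkContinuous₂
    (LinearMap.mk₂ ℝ cwedge
      (fun a a' b => ContinuousAlternatingMap.toAlternatingMap_injective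
        (wedge_add_left a.toAlternatingMap a'.toAlternatingMap b.toAlternatingMap))
      (fun c a b => ContinuousAlternatingMap.toAlternatingMap_injective
        (wedge_smul_left c a.toAlternatingMap b.toAlternatingMap))
      (fun a b b' => ContinuousAlternatingMap.toAlternatingMap_injective
        (wedge_add_right a.toAlternatingMap b.toAlternatingMap b'.toAlternatingMap))
      (fun c a b => ContinuousAlternatingMap.toAlternatingMap_injective
        (wedge_smul_right c a.toAlternatingMap b.toAlternatingMap)))
    (((k.factorial : ℝ) * l.factorial)⁻¹ * (k + l).factorial) norm_cwedge_le

/-- The case of the Leibniz rule in which the second factor is closed at the given point. -/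
lemma extDeriv_cwedge {a : E → E [⋀^Fin k]→L[ℝ] ℂ} {b : E → E [⋀^Fin l]→L[ℝ] ℂ} {x : E}
    (ha : DifferentiableAt ℝ a x) (hb : DifferentiableAt ℝ b x) (hb0 : extDeriv b x = 0)
    (v : Fin (k + l + 1) → E) :
    extDeriv (fun y => cwedge (a y) (b y)) x v =
      cwedge (extDeriv a x) (b x) (v ∘ Fin.cast (Nat.add_right_comm k 1 l)) := by
  have hd : HasFDerivAt (fun y => cwedge (a y) (b y)) _ x :=
    (cwedgeL E k l).hasFDerivAt_of_bilinear ha.hasFDerivAt hb.hasFDerivAt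
  -- The derivative of `a ∧ b` is the sum of `A'`, antisymmetrised to `da ∧ b`, and of `C`, which
  -- agrees up to sign with `B'` and is therefore antisymmetrised to `± db ∧ a = 0`.
  let A : E →ₗ[ℝ] E [⋀^Fin k]→ₗ[ℝ] ℂ :=
    ContinuousAlternatingMap.toAlternatingMapLinear ∘ₗ (fderiv ℝ a x).toLinearMap
  let B : E →ₗ[ℝ] E [⋀^Fin l]→ₗ[ℝ] ℂ :=
    ContinuousAlternatingMap.toAlternatingMapLinear ∘ₗ (fderiv ℝ b x).toLinearMap
  let A' : E →ₗ[ℝ] E [⋀^Fin (k + l)]→ₗ[ℝ] ℂ :=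
    ContinuousAlternatingMap.toAlternatingMapLinear ∘ₗ
      ((cwedgeL E k l).flip (b x) ∘L fderiv ℝ a x).toLinearMap
  let B' : E →ₗ[ℝ] E [⋀^Fin (l + k)]→ₗ[ℝ] ℂ :=
    ContinuousAlternatingMap.toAlternatingMapLinear ∘ₗ
      ((cwedgeL E l k).flip (a x) ∘L fderiv ℝ b x).toLinearMap
  let C : E →ₗ[ℝ] E [⋀^Fin (k + l)]→ₗ[ℝ] ℂ :=
    ContinuousAlternatingMap.toAlternatingMapLinear ∘ₗ
      (cwedgeL E k l (a x) ∘L fderiv ℝ b x).toLinearMap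
  have hA := alternatizeUncurryFin_wedge A (b x).toAlternatingMap A' (fun v => rfl) v
  have hB0 : AlternatingMap.alternatizeUncurryFin B = 0 := by
    have := congrArg ContinuousAlternatingMap.toAlternatingMap hb0
    rwa [extDeriv, ContinuousAlternatingMap.toAlternatingMap_alternatizeUncurryFin] at this
  have hB : AlternatingMap.alternatizeUncurryFin B' = 0 := by
    ext w
    have := alternatizeUncurryFin_wedge B (a x).toAlternatingMap B' (fun v => rfl) w
    rwa [hB0, zero_wedge] at this
  have hC : AlternatingMap.alternatizeUncurryFin C v = 0 := by
    obtain ⟨s, hs⟩ := wedge_comm E ℂ k l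
    have := alternatizeUncurryFin_cast (add_comm l k) (s • B') C
      (fun y u => hs (a x).toAlternatingMap (fderiv ℝ b x y).toAlternatingMap u) v
    rw [this, AlternatingMap.alternatizeUncurryFin_smul, hB, smul_zero, AlternatingMap.zero_apply]
  have hAd : AlternatingMap.alternatizeUncurryFin A = (extDeriv a x).toAlternatingMap := by
    rw [extDeriv, ContinuousAlternatingMap.toAlternatingMap_alternatizeUncurryFin]
  rw [hAd] at hA
  rw [cwedge_apply, ← hA, ← zero_add (AlternatingMap.alternatizeUncurryFin A' v), ← hC, extDeriv,
    hd.fderiv, ContinuousAlternatingMap.alternatizeUncurryFin_add]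
  rw [← ContinuousAlternatingMap.coe_toAlternatingMap,
    ContinuousAlternatingMap.toAlternatingMap_add,
    ContinuousAlternatingMap.toAlternatingMap_alternatizeUncurryFin,
    ContinuousAlternatingMap.toAlternatingMap_alternatizeUncurryFin]
  rfl

end Leibniz

/-! ### Chart expressions and operations on forms -/

section ChartRepresentatives

open Topology Set

variable {m : ℕ} {M : Type*} [TopologicalSpace M] [ChartedSpace (EuclideanSpace ℝ (Fin m)) M]
  {F : Type*} [NormedAddCommGroup F] [NormedSpace ℝ F] {k l : ℕ}

/-- The values of a form at equal points, as alternating maps on the common model space `ℝᵐ` of the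
tangent spaces. -/
lemma DForm.apply_congr (θ : DForm m M F k) {p q : M} (h : p = q)
    (v : Fin k → EuclideanSpace ℝ (Fin m)) :
    (θ p : EuclideanSpace ℝ (Fin m) [⋀^Fin k]→L[ℝ] F) v =
      (θ q : EuclideanSpace ℝ (Fin m) [⋀^Fin k]→L[ℝ] F) v := by
  subst h; rfl

variable [IsManifold (𝓡 m) ∞ M]

/-- The change of coordinates from the chart around `x₀` to the chart around `x₁`. -/
def coordChange (x₀ x₁ : M) : EuclideanSpace ℝ (Fin m) → EuclideanSpace ℝ (Fin m) :=
  extChartAt (𝓡 m) x₁ ∘ (extChartAt (𝓡 m) x₀).symm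

lemma mdifferentiableAt_extChartAt_symm {x₀ : M} {y : EuclideanSpace ℝ (Fin m)}
    (hy : y ∈ (extChartAt (𝓡 m) x₀).target) :
    MDifferentiableAt 𝓘(ℝ, EuclideanSpace ℝ (Fin m)) (𝓡 m) (extChartAt (𝓡 m) x₀).symm y := by
  have : IsManifold (𝓡 m) 1 M := IsManifold.of_le (n := ∞) (by norm_num)
  have := mdifferentiableWithinAt_extChartAt_symm (I := 𝓡 m) hy
  rwa [ModelWithCorners.range_eq_univ, mdifferentiableWithinAt_univ] at this

lemma contDiffAt_coordChange {x₀ x₁ : M} {y : EuclideanSpace ℝ (Fin m)}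
    (hy : y ∈ (extChartAt (𝓡 m) x₀).target)
    (hy' : (extChartAt (𝓡 m) x₀).symm y ∈ (extChartAt (𝓡 m) x₁).source) :
    ContDiffAt ℝ ∞ (coordChange (m := m) x₀ x₁) y := by
  have := contDiffWithinAt_ext_coord_change (I := 𝓡 m) (n := ∞) x₁ x₀ (y := y) (by
    rw [PartialEquiv.trans_source'', PartialEquiv.symm_symm, PartialEquiv.symm_target]
    exact ⟨_, ⟨(extChartAt (𝓡 m) x₀).map_target hy, hy'⟩, (extChartAt (𝓡 m) x₀).right_inv hy⟩)
  rwa [ModelWithCorners.range_eq_univ, contDiffWithinAt_univ] at this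

lemma eventually_mem_target_source {x₀ x₁ : M} {y : EuclideanSpace ℝ (Fin m)}
    (hy : y ∈ (extChartAt (𝓡 m) x₀).target)
    (hy' : (extChartAt (𝓡 m) x₀).symm y ∈ (extChartAt (𝓡 m) x₁).source) :
    ∀ᶠ z in 𝓝 y, z ∈ (extChartAt (𝓡 m) x₀).target ∧
      (extChartAt (𝓡 m) x₀).symm z ∈ (extChartAt (𝓡 m) x₁).source := by
  refine Filter.Eventually.and ((isOpen_extChartAt_target x₀).mem_nhds hy) ?_
  exact ((mdifferentiableAt_extChartAt_symm hy).continuousAt).eventually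
    ((isOpen_extChartAt_source x₁).mem_nhds hy')

lemma mfderiv_extChartAt_symm_eq {x₀ x₁ : M} {y : EuclideanSpace ℝ (Fin m)}
    (hy : y ∈ (extChartAt (𝓡 m) x₀).target)
    (hy' : (extChartAt (𝓡 m) x₀).symm y ∈ (extChartAt (𝓡 m) x₁).source)
    (v : EuclideanSpace ℝ (Fin m)) :
    (mfderiv 𝓘(ℝ, EuclideanSpace ℝ (Fin m)) (𝓡 m) (extChartAt (𝓡 m) x₀).symm y v :
      EuclideanSpace ℝ (Fin m)) =
    mfderiv 𝓘(ℝ, EuclideanSpace ℝ (Fin m)) (𝓡 m) (extChartAt (𝓡 m) x₁).symm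
      (coordChange (m := m) x₀ x₁ y) (fderiv ℝ (coordChange (m := m) x₀ x₁) y v) := by
  have h1 : (extChartAt (𝓡 m) x₀).symm =ᶠ[𝓝 y]
      (extChartAt (𝓡 m) x₁).symm ∘ coordChange (m := m) x₀ x₁ := by
    filter_upwards [eventually_mem_target_source hy hy'] with z hz
    exact ((extChartAt (𝓡 m) x₁).left_inv hz.2).symm
  have h2 : MDifferentiableAt 𝓘(ℝ, EuclideanSpace ℝ (Fin m)) 𝓘(ℝ, EuclideanSpace ℝ (Fin m))
      (coordChange (m := m) x₀ x₁) y :=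
    ((contDiffAt_coordChange hy hy').differentiableAt (by simp)).mdifferentiableAt
  have h3 := mdifferentiableAt_extChartAt_symm (m := m) (x₀ := x₁)
    (y := coordChange (m := m) x₀ x₁ y) ((extChartAt (𝓡 m) x₁).map_source hy')
  have h4 := mfderiv_comp y h3 h2
  rw [mfderiv_eq_fderiv] at h4
  have h5 := h1.mfderiv_eq (I := 𝓘(ℝ, EuclideanSpace ℝ (Fin m))) (I' := 𝓡 m)
  exact (congrArg (fun f => f v) h5).trans (congrArg (fun f => f v) h4)

lemma mfderiv_extChartAt_comp_symm {x₀ x₁ : M} {y : EuclideanSpace ℝ (Fin m)}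
    (hy : y ∈ (extChartAt (𝓡 m) x₀).target)
    (hy' : (extChartAt (𝓡 m) x₀).symm y ∈ (extChartAt (𝓡 m) x₁).source)
    (v : EuclideanSpace ℝ (Fin m)) :
    (mfderiv (𝓡 m) 𝓘(ℝ, EuclideanSpace ℝ (Fin m)) (extChartAt (𝓡 m) x₁)
      ((extChartAt (𝓡 m) x₀).symm y)
      (mfderiv 𝓘(ℝ, EuclideanSpace ℝ (Fin m)) (𝓡 m) (extChartAt (𝓡 m) x₀).symm y v) :
      EuclideanSpace ℝ (Fin m)) = fderiv ℝ (coordChange (m := m) x₀ x₁) y v := by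
  have : IsManifold (𝓡 m) 1 M := IsManifold.of_le (n := ∞) (by norm_num)
  have h := mfderiv_comp y (mdifferentiableAt_extChartAt (I := 𝓡 m) (x := x₁)
    (by rwa [extChartAt_source] at hy')) (mdifferentiableAt_extChartAt_symm hy)
  have h2 : mfderiv 𝓘(ℝ, EuclideanSpace ℝ (Fin m)) 𝓘(ℝ, EuclideanSpace ℝ (Fin m))
    (extChartAt (𝓡 m) x₁ ∘ (extChartAt (𝓡 m) x₀).symm) y =
      fderiv ℝ (coordChange (m := m) x₀ x₁) y := mfderiv_eq_fderiv
  exact (congrArg (fun f => f v) (h.symm.trans h2))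

/-- Chart expressions of a form are related by pullback along the change of coordinates. -/
lemma chartRep_eq_pullback (θ : DForm m M F k) {x₀ x₁ : M} {y : EuclideanSpace ℝ (Fin m)}
    (hy : y ∈ (extChartAt (𝓡 m) x₀).target)
    (hy' : (extChartAt (𝓡 m) x₀).symm y ∈ (extChartAt (𝓡 m) x₁).source) :
    chartRep θ x₀ y = (chartRep θ x₁ (coordChange (m := m) x₀ x₁ y)).compContinuousLinearMap
      (fderiv ℝ (coordChange (m := m) x₀ x₁) y) := by
  ext v
  have hp : (extChartAt (𝓡 m) x₁).symm (coordChange (m := m) x₀ x₁ y) =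
      (extChartAt (𝓡 m) x₀).symm y := (extChartAt (𝓡 m) x₁).left_inv hy'
  refine Eq.trans ?_ (θ.apply_congr hp _).symm
  change (θ ((extChartAt (𝓡 m) x₀).symm y) : EuclideanSpace ℝ (Fin m) [⋀^Fin k]→L[ℝ] F) _ = _
  congr 1
  ext1 i
  exact mfderiv_extChartAt_symm_eq hy hy' (v i)

/-- The exterior derivative, defined at each point in the preferred chart, is computed in an
arbitrary chart by the exterior derivative of the chart expression. -/
lemma chartRep_extD {θ : DForm m M F k} (hθ : SmoothForm θ) {x₀ : M}
    {y : EuclideanSpace ℝ (Fin m)} (hy : y ∈ (extChartAt (𝓡 m) x₀).target) :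
    chartRep (extD θ) x₀ y = extDeriv (chartRep θ x₀) y := by
  set x := (extChartAt (𝓡 m) x₀).symm y with hx
  have hy' : (extChartAt (𝓡 m) x₀).symm y ∈ (extChartAt (𝓡 m) x).source :=
    mem_extChartAt_source x
  have h1 : chartRep θ x₀ =ᶠ[𝓝 y] fun z =>
      (chartRep θ x (coordChange (m := m) x₀ x z)).compContinuousLinearMap
        (fderiv ℝ (coordChange (m := m) x₀ x) z) := by
    filter_upwards [eventually_mem_target_source hy hy'] with z hz
    exact chartRep_eq_pullback θ hz.1 hz.2
  have h2 : DifferentiableAt ℝ (chartRep θ x) (coordChange (m := m) x₀ x y) :=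
    hθ.differentiableAt x
  rw [h1.extDeriv_eq, extDeriv_pullback h2 (contDiffAt_coordChange hy hy')
    (by simpa using WithTop.coe_le_coe.2 (le_top : (2 : ℕ∞) ≤ ⊤))]
  ext v
  change (extDeriv (chartRep θ x) (extChartAt (𝓡 m) x x)) _ =
    (extDeriv (chartRep θ x) (extChartAt (𝓡 m) x x)) _
  congr 1
  ext1 i
  exact mfderiv_extChartAt_comp_symm hy hy' (v i)

lemma mfderiv_extChartAt_symm_comp (x : M) (v : EuclideanSpace ℝ (Fin m)) :
    (mfderiv 𝓘(ℝ, EuclideanSpace ℝ (Fin m)) (𝓡 m) (extChartAt (𝓡 m) x).symm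
      (extChartAt (𝓡 m) x x) (mfderiv (𝓡 m) 𝓘(ℝ, EuclideanSpace ℝ (Fin m))
        (extChartAt (𝓡 m) x) x v) : EuclideanSpace ℝ (Fin m)) = v := by
  have : IsManifold (𝓡 m) 1 M := IsManifold.of_le (n := ∞) (by norm_num)
  have h := mfderivWithin_extChartAt_symm_comp_mfderiv_extChartAt' (I := 𝓡 m)
    (mem_extChartAt_source (I := 𝓡 m) x)
  rw [ModelWithCorners.range_eq_univ, mfderivWithin_univ] at h
  exact congrArg (fun f => f v) h

/-- A form is recovered at the centre of a chart from its chart expression. -/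
lemma chartRep_comp_mfderiv (θ : DForm m M F k) (x : M) :
    (chartRep θ x (extChartAt (𝓡 m) x x)).compContinuousLinearMap
      (mfderiv (𝓡 m) 𝓘(ℝ, EuclideanSpace ℝ (Fin m)) (extChartAt (𝓡 m) x) x) = θ x := by
  ext v
  refine Eq.trans (θ.apply_congr ((extChartAt (𝓡 m) x).left_inv (mem_extChartAt_source x)) _) ?_
  congr 1
  ext1 i
  exact mfderiv_extChartAt_symm_comp x (v i)

end ChartRepresentatives

section FormOperations

variable {m : ℕ} {M : Type*} [TopologicalSpace M] [ChartedSpace (EuclideanSpace ℝ (Fin m)) M]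
  {F G : Type*} [NormedAddCommGroup F] [NormedSpace ℝ F] [NormedAddCommGroup G] [NormedSpace ℝ G]
  {k l : ℕ}

/-- Composition of a form with a linear map between the spaces of values. -/
def mapForm (L : F →L[ℝ] G) (θ : DForm m M F k) : DForm m M G k :=
  fun x => L.compContinuousAlternatingMap (θ x)

lemma chartRep_mapForm (L : F →L[ℝ] G) (θ : DForm m M F k) (x₀ : M) :
    chartRep (mapForm L θ) x₀ = fun y => L.compContinuousAlternatingMap (chartRep θ x₀ y) := rfl

lemma SmoothForm.map (L : F →L[ℝ] G) {θ : DForm m M F k} (hθ : SmoothForm θ) :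
    SmoothForm (mapForm L θ) := fun x₀ =>
  (ContinuousLinearMap.compContinuousAlternatingMapCLM ℝ (EuclideanSpace ℝ (Fin m)) F G (Fin k)
    L).contDiff.comp_contDiffOn (hθ x₀)

lemma extD_mapForm (L : F →L[ℝ] G) {θ : DForm m M F k} (hθ : SmoothForm θ) :
    extD (mapForm L θ) = mapForm L (extD θ) := by
  funext x
  have hd := hθ.differentiableAt x
  have h : extDeriv (chartRep (mapForm L θ) x) (extChartAt (𝓡 m) x x) =
      L.compContinuousAlternatingMap (extDeriv (chartRep θ x) (extChartAt (𝓡 m) x x)) := by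
    have hf := (ContinuousLinearMap.compContinuousAlternatingMapCLM ℝ (EuclideanSpace ℝ (Fin m))
      F G (Fin k) L).hasFDerivAt.comp _ hd.hasFDerivAt
    rw [extDeriv, chartRep_mapForm]
    refine (congrArg ContinuousAlternatingMap.alternatizeUncurryFin hf.fderiv).trans ?_
    ext v
    simp [extDeriv, ContinuousAlternatingMap.alternatizeUncurryFin_apply]
  rw [extD, h]
  rfl

/-- The wedge product of complex valued forms. -/
def wedgeForm (a : DForm m M ℂ k) (b : DForm m M ℂ l) : DForm m M ℂ (k + l) :=
  fun x => cwedge (a x) (b x)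

lemma chartRep_wedgeForm (a : DForm m M ℂ k) (b : DForm m M ℂ l) (x₀ : M) :
    chartRep (wedgeForm a b) x₀ = fun y => cwedge (chartRep a x₀ y) (chartRep b x₀ y) :=
  funext fun _ => (cwedge_comp _ _ _).symm

lemma SmoothForm.wedge {a : DForm m M ℂ k} {b : DForm m M ℂ l} (ha : SmoothForm a)
    (hb : SmoothForm b) : SmoothForm (wedgeForm a b) := fun x₀ => by
  rw [chartRep_wedgeForm]
  exact ((cwedgeL (EuclideanSpace ℝ (Fin m)) k l).isBoundedBilinearMap.contDiff).comp₂_contDiffOn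
    (ha x₀) (hb x₀)

/-- The Leibniz rule for the wedge product with a closed form. -/
lemma extD_wedgeForm [IsManifold (𝓡 m) ∞ M] {a : DForm m M ℂ k} {b : DForm m M ℂ l}
    (ha : SmoothForm a) (hb : SmoothForm b) (hb0 : extD b = 0) (x : M)
    (v : Fin (k + l + 1) → TangentSpace (𝓡 m) x) :
    extD (wedgeForm a b) x v =
      cwedge (extD a x) (b x) (v ∘ Fin.cast (Nat.add_right_comm k 1 l)) := by
  have h0 : extDeriv (chartRep b x) (extChartAt (𝓡 m) x x) = 0 := by
    rw [← chartRep_extD hb (mem_extChartAt_target x), hb0, chartRep_zero]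
    rfl
  have h1 : cwedge (extD a x) (b x) = (cwedge (extDeriv (chartRep a x) (extChartAt (𝓡 m) x x))
      (chartRep b x (extChartAt (𝓡 m) x x))).compContinuousLinearMap
        (mfderiv (𝓡 m) 𝓘(ℝ, EuclideanSpace ℝ (Fin m)) (extChartAt (𝓡 m) x) x) :=
    (congrArg (cwedge (extD a x)) (chartRep_comp_mfderiv b x).symm).trans (cwedge_comp _ _ _)
  rw [h1, extD, chartRep_wedgeForm]
  exact extDeriv_cwedge (ha.differentiableAt x) (hb.differentiableAt x) h0 _

end FormOperations

/-! ### Integration of compactly supported forms on Euclidean space -/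

section Euclidean

open Topology Set MeasureTheory

variable {k : ℕ}

/-- The value of a top degree form on the standard basis of `ℝᵏ⁺¹`. -/
def topCoeff (η : EuclideanSpace ℝ (Fin (k + 1)) [⋀^Fin (k + 1)]→L[ℝ] ℝ) : ℝ :=
  η (EuclideanSpace.basisFun (Fin (k + 1)) ℝ).toBasis

lemma continuous_topCoeff : Continuous (topCoeff (k := k)) :=
  continuous_eval_const _

/-- Pullback along a linear map multiplies a top degree form by the determinant. -/
lemma topCoeff_comp (η : EuclideanSpace ℝ (Fin (k + 1)) [⋀^Fin (k + 1)]→L[ℝ] ℝ)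
    (A : EuclideanSpace ℝ (Fin (k + 1)) →L[ℝ] EuclideanSpace ℝ (Fin (k + 1))) :
    topCoeff (η.compContinuousLinearMap A) = A.det * topCoeff η := by
  set e := (EuclideanSpace.basisFun (Fin (k + 1)) ℝ).toBasis
  have h := η.toAlternatingMap.eq_smul_basis_det e
  have h1 : topCoeff (η.compContinuousLinearMap A) = η.toAlternatingMap (A ∘ e) := rfl
  rw [h1, h, AlternatingMap.smul_apply]
  have h2 : e.det (A ∘ e) = A.det := by
    have := e.det_comp (A : EuclideanSpace ℝ (Fin (k + 1)) →ₗ[ℝ] EuclideanSpace ℝ (Fin (k + 1))) e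
    rw [e.det_self, mul_one] at this
    exact this
  rw [h2, smul_eq_mul, mul_comm]
  rfl

lemma topCoeff_eq_zero_iff {η : EuclideanSpace ℝ (Fin (k + 1)) [⋀^Fin (k + 1)]→L[ℝ] ℝ} :
    topCoeff η = 0 ↔ η = 0 := by
  refine ⟨fun h => ?_, fun h => by rw [h]; rfl⟩
  apply ContinuousAlternatingMap.toAlternatingMap_injective
  rw [η.toAlternatingMap.eq_smul_basis_det (EuclideanSpace.basisFun (Fin (k + 1)) ℝ).toBasis]
  change topCoeff η • _ = 0
  rw [h, zero_smul]

/-- Extension by zero of a function which vanishes outside a compact subset of an open set: near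
each point the extension agrees with the function or vanishes. -/
lemma indicator_eventuallyEq {X N : Type*} [TopologicalSpace X] [T2Space X] [Zero N] {U C : Set X}
    (hU : IsOpen U) (hC : IsCompact C) (hCU : C ⊆ U) {f : X → N} (hf : ∀ x ∈ U, x ∉ C → f x = 0)
    (x : X) : (x ∈ U ∧ U.indicator f =ᶠ[𝓝 x] f) ∨ (x ∉ U ∧ U.indicator f =ᶠ[𝓝 x] 0) := by
  by_cases hx : x ∈ U
  · left
    refine ⟨hx, ?_⟩
    filter_upwards [hU.mem_nhds hx] with y hy
    exact indicator_of_mem hy f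
  · right
    refine ⟨hx, ?_⟩
    filter_upwards [hC.isClosed.isOpen_compl.mem_nhds (fun h => hx (hCU h))] with y hy
    by_cases hyU : y ∈ U
    · rw [indicator_of_mem hyU, hf y hyU hy]; rfl
    · rw [indicator_of_notMem hyU]; rfl

lemma hasCompactSupport_indicator {X N : Type*} [TopologicalSpace X] [T2Space X] [Zero N]
    {U C : Set X} (hC : IsCompact C) {f : X → N} (hf : ∀ x ∈ U, x ∉ C → f x = 0) :
    HasCompactSupport (U.indicator f) := by
  refine HasCompactSupport.intro hC fun x hx => ?_
  by_cases hxU : x ∈ U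
  · rw [indicator_of_mem hxU, hf x hxU hx]
  · exact indicator_of_notMem hxU f

lemma continuous_indicator_of_compact {X N : Type*} [TopologicalSpace X] [T2Space X] [Zero N]
    [TopologicalSpace N] {U C : Set X} (hU : IsOpen U) (hC : IsCompact C) (hCU : C ⊆ U) {f : X → N}
    (hf : ∀ x ∈ U, x ∉ C → f x = 0) (hfc : ContinuousOn f U) : Continuous (U.indicator f) := by
  refine continuous_iff_continuousAt.2 fun x => ?_
  rcases indicator_eventuallyEq hU hC hCU hf x with ⟨hx, h⟩ | ⟨_, h⟩
  · exact (hfc.continuousAt (hU.mem_nhds hx)).congr h.symm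
  · exact continuousAt_const.congr h.symm

lemma integral_fderiv_eq_zero {E : Type*} [NormedAddCommGroup E] [NormedSpace ℝ E]
    [FiniteDimensional ℝ E] [MeasurableSpace E] [BorelSpace E] (μ : Measure E)
    [μ.IsAddHaarMeasure] {g : E → ℝ} (hg : ContDiff ℝ 1 g) (hc : HasCompactSupport g) (v : E) :
    ∫ x, fderiv ℝ g x v ∂μ = 0 := by
  have h1 : Continuous fun x => fderiv ℝ g x v :=
    (hg.continuous_fderiv (by norm_num)).clm_apply continuous_const
  have h2 : HasCompactSupport fun x => fderiv ℝ g x v := hc.fderiv_apply ℝ v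
  have := integral_mul_fderiv_eq_neg_fderiv_mul_of_integrable (μ := μ) (f := fun _ : E => (1 : ℝ))
    (g := g) (v := v) (by simp) (by simpa using h1.integrable_of_hasCompactSupport h2)
    (by simpa using hg.continuous.integrable_of_hasCompactSupport hc)
    (fun _ _ => differentiableAt_const _) (fun x _ => hg.differentiable (by norm_num) x)
  simpa using this

/-- The integral over `ℝᵏ⁺¹` of the exterior derivative of a compactly supported form vanishes. -/
lemma integral_extDeriv_eq_zero
    {G : EuclideanSpace ℝ (Fin (k + 1)) → EuclideanSpace ℝ (Fin (k + 1)) [⋀^Fin k]→L[ℝ] ℝ}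
    (hG : ContDiff ℝ 1 G) (hc : HasCompactSupport G) : ∫ y, topCoeff (extDeriv G y) = 0 := by
  set e := (EuclideanSpace.basisFun (Fin (k + 1)) ℝ).toBasis
  have h : ∀ y, topCoeff (extDeriv G y) =
      ∑ i : Fin (k + 1), (-1 : ℝ) ^ i.val * fderiv ℝ (fun z => G z (i.removeNth e)) y (e i) := by
    intro y
    refine (extDeriv_apply (hG.differentiable (by norm_num) y) e).trans ?_
    simp [zsmul_eq_mul]
  have hgc : ∀ w : Fin k → EuclideanSpace ℝ (Fin (k + 1)), ContDiff ℝ 1 fun z => G z w := fun w =>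
    (ContinuousAlternatingMap.apply ℝ _ ℝ w).contDiff.comp hG
  have hgs : ∀ w : Fin k → EuclideanSpace ℝ (Fin (k + 1)), HasCompactSupport fun z => G z w :=
    fun w => hc.comp_left (g := fun η : EuclideanSpace ℝ (Fin (k + 1)) [⋀^Fin k]→L[ℝ] ℝ => η w) rfl
  -- `dG` is a divergence, and the integral of each partial derivative vanishes.
  simp only [h]
  rw [integral_finsetSum]
  · refine Finset.sum_eq_zero fun i _ => ?_
    rw [integral_const_mul, integral_fderiv_eq_zero _ (hgc _) (hgs _), mul_zero]
  · intro i _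
    refine Integrable.const_mul (Continuous.integrable_of_hasCompactSupport ?_ ?_) _
    · exact ((hgc _).continuous_fderiv (by norm_num)).clm_apply continuous_const
    · exact (hgs _).fderiv_apply ℝ _

end Euclidean

/-! ### The theorem of Stokes on closed manifolds -/

section Stokes

open Topology Set MeasureTheory

variable {k : ℕ} {M : Type*} [TopologicalSpace M]
  [ChartedSpace (EuclideanSpace ℝ (Fin (k + 1))) M]

/-- A form whose chart expressions are continuous. -/
def ContinuousForm {m j : ℕ} {M : Type*} [TopologicalSpace M]
    [ChartedSpace (EuclideanSpace ℝ (Fin m)) M] (θ : DForm m M ℝ j) : Prop :=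
  ∀ x₀ : M, ContinuousOn (chartRep θ x₀) (extChartAt (𝓡 m) x₀).target

/-- The product of a form and a function. -/
def scaleForm {m j : ℕ} {M : Type*} [TopologicalSpace M]
    [ChartedSpace (EuclideanSpace ℝ (Fin m)) M] (f : M → ℝ) (θ : DForm m M ℝ j) : DForm m M ℝ j :=
  fun x => f x • θ x

lemma chartRep_scaleForm {m j : ℕ} {M : Type*} [TopologicalSpace M]
    [ChartedSpace (EuclideanSpace ℝ (Fin m)) M] (f : M → ℝ) (θ : DForm m M ℝ j) (x₀ : M) :
    chartRep (scaleForm f θ) x₀ = fun y => f ((extChartAt (𝓡 m) x₀).symm y) • chartRep θ x₀ y := by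
  ext; rfl

lemma SmoothForm.scale {m j : ℕ} {M : Type*} [TopologicalSpace M]
    [ChartedSpace (EuclideanSpace ℝ (Fin m)) M] [IsManifold (𝓡 m) ∞ M] {f : M → ℝ}
    (hf : ContMDiff (𝓡 m) 𝓘(ℝ, ℝ) ∞ f) {θ : DForm m M ℝ j} (hθ : SmoothForm θ) :
    SmoothForm (scaleForm f θ) := fun x₀ => by
  rw [chartRep_scaleForm]
  have h1 : ContDiffOn ℝ ∞ (f ∘ (extChartAt (𝓡 m) x₀).symm) (extChartAt (𝓡 m) x₀).target :=
    (hf.comp_contMDiffOn (contMDiffOn_extChartAt_symm x₀)).contDiffOn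
  exact h1.smul (hθ x₀)

lemma ContinuousForm.scale {m j : ℕ} {M : Type*} [TopologicalSpace M]
    [ChartedSpace (EuclideanSpace ℝ (Fin m)) M] {f : M → ℝ}
    (hf : Continuous f) {θ : DForm m M ℝ j} (hθ : ContinuousForm θ) :
    ContinuousForm (scaleForm f θ) := fun x₀ => by
  rw [chartRep_scaleForm]
  exact (hf.comp_continuousOn (continuousOn_extChartAt_symm x₀)).smul (hθ x₀)

lemma SmoothForm.continuousForm_extD {m j : ℕ} {M : Type*} [TopologicalSpace M]
    [ChartedSpace (EuclideanSpace ℝ (Fin m)) M] [IsManifold (𝓡 m) ∞ M] {θ : DForm m M ℝ j}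
    (hθ : SmoothForm θ) : ContinuousForm (extD θ) := fun x₀ => by
  have h1 := (hθ x₀).continuousOn_fderiv_of_isOpen (isOpen_extChartAt_target x₀) (by simp)
  have h2 : ContinuousOn (extDeriv (chartRep θ x₀)) (extChartAt (𝓡 m) x₀).target :=
    (ContinuousAlternatingMap.alternatizeUncurryFinCLM ℝ (EuclideanSpace ℝ (Fin m))
      ℝ).continuous.comp_continuousOn h1
  exact h2.congr fun y hy => chartRep_extD hθ hy

lemma extD_sum {m j : ℕ} {M : Type*} [TopologicalSpace M]
    [ChartedSpace (EuclideanSpace ℝ (Fin m)) M] {ι : Type*} (s : Finset ι) (θ : ι → DForm m M ℝ j)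
    (hθ : ∀ i, SmoothForm (θ i)) :
    SmoothForm (∑ i ∈ s, θ i) ∧ extD (∑ i ∈ s, θ i) = ∑ i ∈ s, extD (θ i) := by
  classical
  induction s using Finset.induction_on with
  | empty => exact ⟨SmoothForm.zero, extD_zero⟩
  | insert i s hi ih =>
    rw [Finset.sum_insert hi, Finset.sum_insert hi, extD_add (hθ i) ih.1, ih.2]
    exact ⟨(hθ i).add ih.1, rfl⟩

/-- The exterior derivative is a local operator: it does not increase supports. -/
lemma extD_eq_zero_of_notMem {m j : ℕ} {M : Type*} [TopologicalSpace M]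
    [ChartedSpace (EuclideanSpace ℝ (Fin m)) M] {θ : DForm m M ℝ j} {K : Set M} (hK : IsClosed K)
    (hθ : ∀ x, x ∉ K → θ x = 0) {x : M} (hx : x ∉ K) : extD θ x = 0 := by
  have h1 : chartRep θ x =ᶠ[𝓝 (extChartAt (𝓡 m) x x)] chartRep (0 : DForm m M ℝ j) x := by
    filter_upwards [(continuousAt_extChartAt_symm (I := 𝓡 m) x).eventually_mem
      (hK.isOpen_compl.mem_nhds (by simpa using hx))] with y hy
    ext v
    rw [chartRep, hθ _ hy]
    rfl
  rw [extD, h1.extDeriv_eq]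
  exact congrFun extD_zero x

variable [IsManifold (𝓡 (k + 1)) ∞ M]

/-- The integral over the chart around `x₀` of a top degree form `η`, the chart being oriented at
each point by the top degree form `ν`. -/
def chartIntegral (ν η : DForm (k + 1) M ℝ (k + 1)) (x₀ : M) : ℝ :=
  ∫ y in (extChartAt (𝓡 (k + 1)) x₀).target,
    Real.sign (topCoeff (chartRep ν x₀ y)) * topCoeff (chartRep η x₀ y)

/-- `η` vanishes outside a compact subset of the domain of the chart around `x₀`. -/
def SupportedInChart {m j : ℕ} {M : Type*} [TopologicalSpace M]
    [ChartedSpace (EuclideanSpace ℝ (Fin m)) M] (η : DForm m M ℝ j) (x₀ : M) : Prop :=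
  ∃ K : Set M, IsCompact K ∧ IsClosed K ∧ K ⊆ (extChartAt (𝓡 m) x₀).source ∧ ∀ x, x ∉ K → η x = 0

lemma SupportedInChart.exists_compact {m j : ℕ} {M : Type*} [TopologicalSpace M]
    [ChartedSpace (EuclideanSpace ℝ (Fin m)) M] {η : DForm m M ℝ j} {x₀ : M}
    (h : SupportedInChart η x₀) : ∃ C : Set (EuclideanSpace ℝ (Fin m)), IsCompact C ∧
      C ⊆ (extChartAt (𝓡 m) x₀).target ∧
      ∀ y ∈ (extChartAt (𝓡 m) x₀).target, y ∉ C → chartRep η x₀ y = 0 := by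
  obtain ⟨K, hK, -, hKs, hη⟩ := h
  refine ⟨extChartAt (𝓡 m) x₀ '' K, hK.image_of_continuousOn
    ((continuousOn_extChartAt x₀).mono hKs), ?_, fun y hy hyC => ?_⟩
  · rintro _ ⟨x, hx, rfl⟩
    exact (extChartAt (𝓡 m) x₀).map_source (hKs hx)
  · ext v
    rw [chartRep, hη _ fun h => hyC ⟨_, h, (extChartAt (𝓡 m) x₀).right_inv hy⟩]
    rfl

/-- The chart expression of a form vanishes only where the form does, because the tangent map of a
chart is invertible. -/
lemma chartRep_injective {m j : ℕ} {M : Type*} [TopologicalSpace M]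
    [ChartedSpace (EuclideanSpace ℝ (Fin m)) M] [IsManifold (𝓡 m) ∞ M] (ν : DForm m M ℝ j)
    {x₀ : M} {y : EuclideanSpace ℝ (Fin m)} (hy : y ∈ (extChartAt (𝓡 m) x₀).target)
    (h : chartRep ν x₀ y = 0) : ν ((extChartAt (𝓡 m) x₀).symm y) = 0 := by
  set x := (extChartAt (𝓡 m) x₀).symm y with hx
  have hxs : x ∈ (extChartAt (𝓡 m) x₀).source := (extChartAt (𝓡 m) x₀).map_target hy
  have hyx : coordChange (m := m) x x₀ (extChartAt (𝓡 m) x x) = y := by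
    rw [coordChange, Function.comp_apply,
      (extChartAt (𝓡 m) x).left_inv (mem_extChartAt_source x), hx,
      (extChartAt (𝓡 m) x₀).right_inv hy]
  have h1 := chartRep_eq_pullback ν (mem_extChartAt_target (I := 𝓡 m) x) (x₁ := x₀)
    (by rwa [(extChartAt (𝓡 m) x).left_inv (mem_extChartAt_source x)])
  rw [hyx, h] at h1
  rw [← chartRep_comp_mfderiv ν x, h1]
  rfl

/-- Where the top degree form `ν` does not vanish, its sign is locally constant in a chart. -/
lemma eventually_sign_eq {ν : DForm (k + 1) M ℝ (k + 1)} (hν : ContinuousForm ν)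
    (hν0 : ∀ x, ν x ≠ 0) {x₀ : M} {y : EuclideanSpace ℝ (Fin (k + 1))}
    (hy : y ∈ (extChartAt (𝓡 (k + 1)) x₀).target) :
    ∀ᶠ z in 𝓝 y, Real.sign (topCoeff (chartRep ν x₀ z)) =
      Real.sign (topCoeff (chartRep ν x₀ y)) := by
  have hc : ContinuousAt (fun z => topCoeff (chartRep ν x₀ z)) y :=
    (continuous_topCoeff.comp_continuousOn (hν x₀)).continuousAt
      ((isOpen_extChartAt_target x₀).mem_nhds hy)
  have h0 : topCoeff (chartRep ν x₀ y) ≠ 0 := fun h =>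
    hν0 _ (chartRep_injective ν hy (topCoeff_eq_zero_iff.1 h))
  rcases lt_or_gt_of_ne h0 with h | h
  · filter_upwards [hc.eventually_lt_const h] with z hz
    rw [Real.sign_of_neg hz, Real.sign_of_neg h]
  · filter_upwards [hc.eventually_const_lt h] with z hz
    rw [Real.sign_of_pos hz, Real.sign_of_pos h]

lemma continuousOn_chartIntegrand {ν η : DForm (k + 1) M ℝ (k + 1)} (hν : ContinuousForm ν)
    (hν0 : ∀ x, ν x ≠ 0) (hη : ContinuousForm η) (x₀ : M) :
    ContinuousOn (fun y => Real.sign (topCoeff (chartRep ν x₀ y)) * topCoeff (chartRep η x₀ y))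
      (extChartAt (𝓡 (k + 1)) x₀).target := by
  refine ContinuousOn.mul (fun y hy => ?_) (continuous_topCoeff.comp_continuousOn (hη x₀))
  exact (continuousAt_const.congr
    ((eventually_sign_eq hν hν0 hy).mono fun z hz => hz.symm)).continuousWithinAt

lemma integrableOn_chartIntegrand {ν η : DForm (k + 1) M ℝ (k + 1)} (hν : ContinuousForm ν)
    (hν0 : ∀ x, ν x ≠ 0) (hη : ContinuousForm η) {x₀ : M} (hs : SupportedInChart η x₀) :
    IntegrableOn (fun y => Real.sign (topCoeff (chartRep ν x₀ y)) * topCoeff (chartRep η x₀ y))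
      (extChartAt (𝓡 (k + 1)) x₀).target := by
  obtain ⟨C, hC, hCt, h0⟩ := hs.exists_compact
  have h1 : ∀ y ∈ (extChartAt (𝓡 (k + 1)) x₀).target, y ∉ C →
      Real.sign (topCoeff (chartRep ν x₀ y)) * topCoeff (chartRep η x₀ y) = 0 := fun y hy hyC => by
    rw [topCoeff_eq_zero_iff.2 (h0 y hy hyC), mul_zero]
  rw [← integrable_indicator_iff (isOpen_extChartAt_target x₀).measurableSet]
  exact (continuous_indicator_of_compact (isOpen_extChartAt_target x₀) hC hCt h1
    (continuousOn_chartIntegrand hν hν0 hη x₀)).integrable_of_hasCompactSupport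
    (hasCompactSupport_indicator hC h1)

lemma chartIntegral_sum {ν : DForm (k + 1) M ℝ (k + 1)} (hν : ContinuousForm ν)
    (hν0 : ∀ x, ν x ≠ 0) {ι : Type*} (s : Finset ι) (η : ι → DForm (k + 1) M ℝ (k + 1))
    (hη : ∀ i, ContinuousForm (η i)) {x₀ : M} (hs : ∀ i, SupportedInChart (η i) x₀) :
    chartIntegral ν (∑ i ∈ s, η i) x₀ = ∑ i ∈ s, chartIntegral ν (η i) x₀ := by
  unfold chartIntegral
  rw [← integral_finsetSum _ fun i _ => integrableOn_chartIntegrand hν hν0 (hη i) (hs i)]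
  refine integral_congr_ae (Filter.Eventually.of_forall fun y => ?_)
  have h1 : chartRep (∑ i ∈ s, η i) x₀ y = ∑ i ∈ s, chartRep (η i) x₀ y := by
    classical
    induction s using Finset.induction_on with
    | empty => exact congrFun (chartRep_zero x₀) y
    | insert i s hi ih =>
      rw [Finset.sum_insert hi, Finset.sum_insert hi, ← ih, chartRep_add]
      rfl
  have h2 : topCoeff (∑ i ∈ s, chartRep (η i) x₀ y) = ∑ i ∈ s, topCoeff (chartRep (η i) x₀ y) :=
    map_sum (ContinuousAlternatingMap.apply ℝ (EuclideanSpace ℝ (Fin (k + 1))) ℝ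
      (EuclideanSpace.basisFun (Fin (k + 1)) ℝ).toBasis) _ _
  simp only [h1, h2, Finset.mul_sum]

/-- Stokes' theorem for forms supported in the domain of one chart. -/
lemma chartIntegral_extD_eq_zero {ν : DForm (k + 1) M ℝ (k + 1)} (hν : ContinuousForm ν)
    (hν0 : ∀ x, ν x ≠ 0) {θ : DForm (k + 1) M ℝ k} (hθ : SmoothForm θ) {x₀ : M}
    (hs : SupportedInChart θ x₀) : chartIntegral ν (extD θ) x₀ = 0 := by
  obtain ⟨C, hC, hCt, h0⟩ := hs.exists_compact
  have ho := isOpen_extChartAt_target (I := 𝓡 (k + 1)) x₀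
  -- The locally constant sign can be moved under the exterior derivative, and the product extends
  -- by zero to a form on `ℝᵏ⁺¹`.
  let f : EuclideanSpace ℝ (Fin (k + 1)) → EuclideanSpace ℝ (Fin (k + 1)) [⋀^Fin k]→L[ℝ] ℝ :=
    fun y => Real.sign (topCoeff (chartRep ν x₀ y)) • chartRep θ x₀ y
  let G := (extChartAt (𝓡 (k + 1)) x₀).target.indicator f
  have hf0 : ∀ y ∈ (extChartAt (𝓡 (k + 1)) x₀).target, y ∉ C → f y = 0 := fun y hy hyC => by
    simp only [f, h0 y hy hyC, smul_zero]
  have hloc : ∀ y, (y ∈ (extChartAt (𝓡 (k + 1)) x₀).target ∧ G =ᶠ[𝓝 y]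
      Real.sign (topCoeff (chartRep ν x₀ y)) • chartRep θ x₀) ∨
      (y ∉ (extChartAt (𝓡 (k + 1)) x₀).target ∧ G =ᶠ[𝓝 y] 0) := by
    intro y
    refine (indicator_eventuallyEq ho hC hCt hf0 y).imp_left fun h => ⟨h.1, h.2.trans ?_⟩
    filter_upwards [eventually_sign_eq hν hν0 h.1] with z hz
    simp only [f, hz]
    rfl
  have hG : ContDiff ℝ 1 G := by
    refine contDiff_iff_contDiffAt.2 fun y => ?_
    rcases hloc y with ⟨hy, h⟩ | ⟨_, h⟩
    · refine ContDiffAt.congr_of_eventuallyEq ?_ h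
      have h1 : ContDiffAt ℝ 1 (chartRep θ x₀) y := ((hθ x₀).contDiffAt (ho.mem_nhds hy)).of_le
        (WithTop.coe_le_coe.2 (le_top : (1 : ℕ∞) ≤ ⊤))
      exact contDiffAt_const.smul h1
    · exact contDiffAt_const.congr_of_eventuallyEq h
  have hcs : HasCompactSupport G := hasCompactSupport_indicator hC hf0
  rw [← integral_extDeriv_eq_zero hG hcs, chartIntegral, ← integral_indicator ho.measurableSet]
  refine integral_congr_ae (Filter.Eventually.of_forall fun y => ?_)
  change _ = topCoeff (extDeriv G y)
  rcases hloc y with ⟨hy, h⟩ | ⟨hy, h⟩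
  · rw [indicator_of_mem hy, h.extDeriv_eq, extDeriv_smul, chartRep_extD hθ hy]
    rfl
  · rw [indicator_of_notMem hy, h.extDeriv_eq]
    have : extDeriv (0 : EuclideanSpace ℝ (Fin (k + 1)) →
        EuclideanSpace ℝ (Fin (k + 1)) [⋀^Fin k]→L[ℝ] ℝ) y = 0 := by
      have := extDeriv_smul (0 : ℝ) (0 : EuclideanSpace ℝ (Fin (k + 1)) →
        EuclideanSpace ℝ (Fin (k + 1)) [⋀^Fin k]→L[ℝ] ℝ) (x := y)
      rwa [zero_smul, zero_smul] at this
    rw [this]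
    rfl

/-- The change of variables formula: the integral of a form over a chart does not depend on the
chart, provided the form vanishes outside the domains of both charts. -/
lemma chartIntegral_eq {ν : DForm (k + 1) M ℝ (k + 1)} (hν0 : ∀ x, ν x ≠ 0)
    {η : DForm (k + 1) M ℝ (k + 1)} {x₀ x₁ : M}
    (h0 : ∀ x, x ∉ (extChartAt (𝓡 (k + 1)) x₀).source → η x = 0)
    (h1 : ∀ x, x ∉ (extChartAt (𝓡 (k + 1)) x₁).source → η x = 0) :
    chartIntegral ν η x₀ = chartIntegral ν η x₁ := by
  -- `S p q` is the overlap of the two charts, seen in the chart around `p`.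
  let S : M → M → Set (EuclideanSpace ℝ (Fin (k + 1))) := fun p q =>
    {y | y ∈ (extChartAt (𝓡 (k + 1)) p).target ∧
      (extChartAt (𝓡 (k + 1)) p).symm y ∈ (extChartAt (𝓡 (k + 1)) q).source}
  have hSo : ∀ p q, IsOpen (S p q) := fun p q =>
    isOpen_iff_mem_nhds.2 fun y hy => eventually_mem_target_source hy.1 hy.2
  have hres : ∀ p q, (∀ x, x ∉ (extChartAt (𝓡 (k + 1)) q).source → η x = 0) →
      chartIntegral ν η p = ∫ y in S p q,
        Real.sign (topCoeff (chartRep ν p y)) * topCoeff (chartRep η p y) := by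
    intro p q hq
    refine setIntegral_eq_of_subset_of_forall_sdiff_eq_zero
      (isOpen_extChartAt_target p).measurableSet (fun y hy => hy.1) fun y hy => ?_
    have : chartRep η p y = 0 := by
      ext v
      rw [chartRep, hq _ fun h => hy.2 ⟨hy.1, h⟩]
      rfl
    rw [topCoeff_eq_zero_iff.2 this, mul_zero]
  have hinv : ∀ p q, ∀ y ∈ S p q, coordChange (m := k + 1) p q y ∈ S q p ∧
      coordChange (m := k + 1) q p (coordChange (m := k + 1) p q y) = y := by
    intro p q y hy
    have e : (extChartAt (𝓡 (k + 1)) q).symm (coordChange (m := k + 1) p q y) =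
        (extChartAt (𝓡 (k + 1)) p).symm y := (extChartAt (𝓡 (k + 1)) q).left_inv hy.2
    refine ⟨⟨(extChartAt (𝓡 (k + 1)) q).map_source hy.2, ?_⟩, ?_⟩
    · rw [e]
      exact (extChartAt (𝓡 (k + 1)) p).map_target hy.1
    · rw [coordChange, Function.comp_apply, e, (extChartAt (𝓡 (k + 1)) p).right_inv hy.1]
  have himg : coordChange (m := k + 1) x₀ x₁ '' S x₀ x₁ = S x₁ x₀ := by
    ext z
    refine ⟨?_, fun hz => ⟨_, (hinv x₁ x₀ z hz).1, (hinv x₁ x₀ z hz).2⟩⟩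
    rintro ⟨y, hy, rfl⟩
    exact (hinv x₀ x₁ y hy).1
  rw [hres x₀ x₁ h1, hres x₁ x₀ h0, ← himg,
    integral_image_eq_integral_abs_det_fderiv_smul volume (hSo x₀ x₁).measurableSet
      (f' := fderiv ℝ (coordChange (m := k + 1) x₀ x₁))
      (fun y hy => ((contDiffAt_coordChange hy.1 hy.2).differentiableAt
        (by simp)).hasFDerivAt.hasFDerivWithinAt)
      (fun y hy z hz h => by rw [← (hinv x₀ x₁ y hy).2, h, (hinv x₀ x₁ z hz).2])]
  refine setIntegral_congr_fun (hSo x₀ x₁).measurableSet fun y hy => ?_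
  have hy0 : topCoeff (chartRep ν x₀ y) ≠ 0 := fun h =>
    hν0 _ (chartRep_injective ν hy.1 (topCoeff_eq_zero_iff.1 h))
  rw [chartRep_eq_pullback ν hy.1 hy.2, topCoeff_comp] at hy0 ⊢
  rw [chartRep_eq_pullback η hy.1 hy.2, topCoeff_comp, smul_eq_mul]
  have hd := left_ne_zero_of_mul hy0
  have hn := right_ne_zero_of_mul hy0
  -- Forms are pulled back with the factor `det`, the change of variables has the factor `|det|`;
  -- the difference in sign is compensated by the signs of `ν` in the two charts.
  rcases lt_or_gt_of_ne hd with hd | hd <;> rcases lt_or_gt_of_ne hn with hn | hn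
  · rw [Real.sign_of_pos (mul_pos_of_neg_of_neg hd hn), Real.sign_of_neg hn, abs_of_neg hd]; ring
  · rw [Real.sign_of_neg (mul_neg_of_neg_of_pos hd hn), Real.sign_of_pos hn, abs_of_neg hd]; ring
  · rw [Real.sign_of_neg (mul_neg_of_pos_of_neg hd hn), Real.sign_of_neg hn, abs_of_pos hd]; ring
  · rw [Real.sign_of_pos (mul_pos hd hn), Real.sign_of_pos hn, abs_of_pos hd]; ring

/-- Stokes' theorem on a closed manifold, in the form that is needed: an exact form of top degree
vanishes somewhere. Otherwise this form `ν` orients the manifold, and for a partition of unity `ρ`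
subordinate to finitely many charts the integrals of the forms `ρᵢ ν` are positive in total, whereas
`ρᵢ ν` is the sum over `j` of the forms `ρᵢ d(ρⱼ γ)`, whose integrals can be computed in the
`j`-th chart and add up to the integral of `d(ρⱼ γ)`, which vanishes. -/
theorem exists_extD_eq_zero [T2Space M] [CompactSpace M] [Nonempty M] {γ : DForm (k + 1) M ℝ k}
    (hγ : SmoothForm γ) : ∃ x, extD γ x = 0 := by
  by_contra! hν0
  set ν := extD γ with hν_def
  have hν : ContinuousForm ν := hγ.continuousForm_extD
  obtain ⟨t, ht⟩ := isCompact_univ.elim_finite_subcover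
    (fun x : M => (extChartAt (𝓡 (k + 1)) x).source) (fun x => isOpen_extChartAt_source x)
    (fun x _ => mem_iUnion.2 ⟨x, mem_extChartAt_source x⟩)
  obtain ⟨ρ, hρ⟩ := SmoothPartitionOfUnity.exists_isSubordinate (𝓡 (k + 1)) isClosed_univ
    (fun i : t => (extChartAt (𝓡 (k + 1)) (i : M)).source) (fun i => isOpen_extChartAt_source _)
    (fun x hx => by
      obtain ⟨i, hi, hx⟩ := mem_iUnion₂.1 (ht hx)
      exact mem_iUnion.2 ⟨⟨i, hi⟩, hx⟩)
  have hsum : ∀ x, ∑ i, ρ i x = 1 := fun x => by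
    rw [← finsum_eq_sum_of_fintype]
    exact ρ.sum_eq_one (mem_univ x)
  have hρs : ∀ i, ContMDiff (𝓡 (k + 1)) 𝓘(ℝ, ℝ) ∞ (ρ i) := fun i => (ρ i).contMDiff
  have hρc : ∀ i, Continuous (ρ i) := fun i => (hρs i).continuous
  have hρ0 : ∀ i x, x ∉ tsupport (ρ i) → ρ i x = 0 := fun i x hx =>
    image_eq_zero_of_notMem_tsupport hx
  have hK : ∀ i, IsCompact (tsupport (ρ i)) := fun i => (isClosed_tsupport _).isCompact
  have hscale : ∀ {j : ℕ} (i : t) (η : DForm (k + 1) M ℝ j) (x : M), x ∉ tsupport (ρ i) →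
      scaleForm (ρ i) η x = 0 := fun i η x hx => by rw [scaleForm, hρ0 i x hx, zero_smul]
  have hsupp : ∀ {j : ℕ} (i : t) (η : DForm (k + 1) M ℝ j),
      SupportedInChart (scaleForm (ρ i) η) (i : M) := fun i η =>
    ⟨tsupport (ρ i), hK i, isClosed_tsupport _, hρ i, hscale i η⟩
  have hθ : ∀ j, SmoothForm (scaleForm (ρ j) γ) := fun j => hγ.scale (hρs j)
  have hD0 : ∀ (j : t) (x : M), x ∉ tsupport (ρ j) → extD (scaleForm (ρ j) γ) x = 0 :=
    fun j x hx => extD_eq_zero_of_notMem (isClosed_tsupport _) (hscale j γ) hx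
  have hdecomp : ν = ∑ j, extD (scaleForm (ρ j) γ) := by
    rw [← (extD_sum Finset.univ _ hθ).2, hν_def]
    congr 1
    funext x
    rw [Finset.sum_apply]
    simp only [scaleForm]
    rw [← Finset.sum_smul, hsum, one_smul]
  have hone : ∀ η : DForm (k + 1) M ℝ (k + 1), ∑ i, scaleForm (ρ i) η = η := fun η => by
    funext x
    rw [Finset.sum_apply]
    simp only [scaleForm]
    rw [← Finset.sum_smul, hsum, one_smul]
  have hcD : ∀ j, ContinuousForm (extD (scaleForm (ρ j) γ)) := fun j => (hθ j).continuousForm_extD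
  -- The total integral of `ν` vanishes.
  have hzero : ∑ i : t, chartIntegral ν (scaleForm (ρ i) ν) (i : M) = 0 := by
    have h1 : ∀ i : t, chartIntegral ν (scaleForm (ρ i) ν) (i : M) =
        ∑ j, chartIntegral ν (scaleForm (ρ i) (extD (scaleForm (ρ j) γ))) (j : M) := by
      intro i
      have : scaleForm (ρ i) ν = ∑ j, scaleForm (ρ i) (extD (scaleForm (ρ j) γ)) := by
        funext x
        rw [Finset.sum_apply]
        simp only [scaleForm]
        rw [← Finset.smul_sum, hdecomp, Finset.sum_apply]
      rw [this, chartIntegral_sum hν hν0 _ _ (fun j => (hcD j).scale (hρc i))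
        (fun j => hsupp i _)]
      refine Finset.sum_congr rfl fun j _ => chartIntegral_eq hν0 (fun x hx => ?_) fun x hx => ?_
      · exact hscale i _ x fun h => hx (hρ i h)
      · rw [scaleForm, hD0 j x fun h => hx (hρ j h), smul_zero]
    rw [Finset.sum_congr rfl fun i _ => h1 i, Finset.sum_comm]
    refine Finset.sum_eq_zero fun j _ => ?_
    rw [← chartIntegral_sum hν hν0 _ _ (fun i => (hcD j).scale (hρc i)), hone]
    · exact chartIntegral_extD_eq_zero hν hν0 (hθ j) (hsupp j γ)
    · exact fun i => ⟨tsupport (ρ j), hK j, isClosed_tsupport _, hρ j, fun x hx => by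
        rw [scaleForm, hD0 j x hx, smul_zero]⟩
  have hintegrand : ∀ (i : t) (y : EuclideanSpace ℝ (Fin (k + 1))),
      Real.sign (topCoeff (chartRep ν (i : M) y)) *
        topCoeff (chartRep (scaleForm (ρ i) ν) (i : M) y) =
      ρ i ((extChartAt (𝓡 (k + 1)) (i : M)).symm y) *
        (Real.sign (topCoeff (chartRep ν (i : M) y)) * topCoeff (chartRep ν (i : M) y)) := by
    intro i y
    have : topCoeff (chartRep (scaleForm (ρ i) ν) (i : M) y) =
      ρ i ((extChartAt (𝓡 (k + 1)) (i : M)).symm y) * topCoeff (chartRep ν (i : M) y) := rfl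
    rw [this]
    ring
  have hintegrand_nonneg : ∀ (i : t) (y : EuclideanSpace ℝ (Fin (k + 1))),
      0 ≤ Real.sign (topCoeff (chartRep ν (i : M) y)) *
        topCoeff (chartRep (scaleForm (ρ i) ν) (i : M) y) := fun i y => by
    rw [hintegrand]
    exact mul_nonneg (ρ.nonneg i _) (Real.sign_mul_nonneg _)
  have hnonneg : ∀ i : t, 0 ≤ chartIntegral ν (scaleForm (ρ i) ν) (i : M) := fun i =>
    integral_nonneg (hintegrand_nonneg i)
  -- On the other hand, `ν` is positive for the orientation which it defines.
  have hpos : ∀ (i : t) (x : M), ρ i x ≠ 0 →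
      0 < chartIntegral ν (scaleForm (ρ i) ν) (i : M) := by
    intro i x hx
    have ho := isOpen_extChartAt_target (I := 𝓡 (k + 1)) (i : M)
    have hxs : x ∈ (extChartAt (𝓡 (k + 1)) (i : M)).source :=
      hρ i (subset_tsupport _ hx)
    have hyt := (extChartAt (𝓡 (k + 1)) (i : M)).map_source hxs
    obtain ⟨C, hC, hCt, h0⟩ := (hsupp i ν).exists_compact
    have h1 : ∀ y ∈ (extChartAt (𝓡 (k + 1)) (i : M)).target, y ∉ C →
        Real.sign (topCoeff (chartRep ν (i : M) y)) *
          topCoeff (chartRep (scaleForm (ρ i) ν) (i : M) y) = 0 := fun y hy hyC => by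
      rw [topCoeff_eq_zero_iff.2 (h0 y hy hyC), mul_zero]
    rw [chartIntegral, ← integral_indicator ho.measurableSet]
    refine (continuous_indicator_of_compact ho hC hCt h1 (continuousOn_chartIntegrand hν hν0
      (hν.scale (hρc i)) (i : M))).integral_pos_of_hasCompactSupport_nonneg_nonzero
      (hasCompactSupport_indicator hC h1) (fun y => indicator_nonneg
        (fun y _ => hintegrand_nonneg i y) y) (x := extChartAt (𝓡 (k + 1)) (i : M) x) ?_
    rw [indicator_of_mem hyt, hintegrand, (extChartAt (𝓡 (k + 1)) (i : M)).left_inv hxs]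
    refine mul_ne_zero hx (Real.sign_mul_pos_of_ne_zero _ fun h => ?_).ne'
    exact hν0 _ (chartRep_injective ν hyt (topCoeff_eq_zero_iff.1 h))
  obtain ⟨x⟩ := ‹Nonempty M›
  obtain ⟨i, hi⟩ : ∃ i, ρ i x ≠ 0 := by
    by_contra! h
    simpa [h] using hsum x
  have := (Finset.sum_eq_zero_iff_of_nonneg fun i _ => hnonneg i).1 hzero i (Finset.mem_univ i)
  exact (hpos i x hi).ne' this

end Stokes

/-! ### Pointwise identities for contact Calabi–Yau structures -/

section PointwiseTop

variable {V : Type*} [AddCommGroup V] [Module ℝ V] {k l p : ℕ}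

lemma wedge_csmul_left (c : ℂ) (a : V [⋀^Fin k]→ₗ[ℝ] ℂ) (b : V [⋀^Fin l]→ₗ[ℝ] ℂ) :
    wedge (c • a) b = c • wedge a b := by
  ext v
  simp only [wedge_apply, AlternatingMap.smul_apply, smul_mul_assoc, smul_comm _ c,
    ← Finset.smul_sum]

lemma wedge_csmul_right (c : ℂ) (a : V [⋀^Fin k]→ₗ[ℝ] ℂ) (b : V [⋀^Fin l]→ₗ[ℝ] ℂ) :
    wedge a (c • b) = c • wedge a b := by
  ext v
  simp only [wedge_apply, AlternatingMap.smul_apply, mul_smul_comm, smul_comm _ c,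
    ← Finset.smul_sum]

variable (V k p l) in
/-- In a product of three forms the middle factor can be moved to the front, at the cost of a sign
which depends on nothing but the degrees. -/
lemma wedge_left_comm : ∃ s : ℤˣ, ∀ (a : V [⋀^Fin k]→ₗ[ℝ] ℂ) (c : V [⋀^Fin p]→ₗ[ℝ] ℂ)
    (b : V [⋀^Fin l]→ₗ[ℝ] ℂ) (v : Fin (k + (p + l)) → V),
    wedge a (wedge c b) v =
      s • wedge c (wedge a b) (v ∘ Fin.cast (add_left_comm p k l)) := by
  obtain ⟨s, hs⟩ := wedge_comm V ℂ k p
  refine ⟨s, fun a c b v => ?_⟩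
  rw [← wedge_assoc, ← wedge_assoc]
  have hs' : wedge (s • wedge c a) b = s • wedge (wedge c a) b := by
    rcases Int.units_eq_one_or s with rfl | rfl
    · simp
    · simpa using wedge_smul_left (-1 : ℝ) (wedge c a) b
  rw [wedge_cast_left (add_comm p k) (s • wedge c a) (wedge a c) (fun u => hs a c u), hs']
  rfl

/-- The wedge product `η ∧ ε̄` with `η = c₁ ε + c₂ ε̄` only sees the component `c₁ ε`, because
`ε̄ ∧ ε̄ = 0` for degree reasons. -/
lemma wedge_conjForm_comb [FiniteDimensional ℝ V] {J : V →ₗ[ℝ] V} {ε : V [⋀^Fin p]→ₗ[ℝ] ℂ}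
    (hε : IsHolType J ε) (c₁ c₂ : ℂ) (hc : c₂ = 0 ∨ Module.finrank ℝ V < 2 * (p + p)) :
    wedge (c₁ • ε + c₂ • conjForm ε) (conjForm ε) = c₁ • wedge ε (conjForm ε) := by
  rw [wedge_add_left, wedge_csmul_left, wedge_csmul_left, add_eq_left]
  rcases hc with rfl | hc
  · rw [zero_smul]
  · rw [conjForm_wedge, (hε.wedge hε).eq_zero hc]
    ext v
    simp

end PointwiseTop

section ContactPointwise

variable {n : ℕ} {M : Type*} [TopologicalSpace M]
  [ChartedSpace (EuclideanSpace ℝ (Fin (2 * n + 1))) M]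
  {α : DForm (2 * n + 1) M ℝ 1} {J : EndField (2 * n + 1) M} {ε : DForm (2 * n + 1) M ℂ n}

/-- The tangent spaces are finite dimensional, being copies of the model space; the definition of
`TangentSpace` is not unfolded by instance search. -/
instance finiteDimensional_tangentSpace (x : M) :
    FiniteDimensional ℝ (TangentSpace (𝓡 (2 * n + 1)) x) :=
  inferInstanceAs (FiniteDimensional ℝ (EuclideanSpace ℝ (Fin (2 * n + 1))))

lemma finrank_tangentSpace (x : M) :
    Module.finrank ℝ (TangentSpace (𝓡 (2 * n + 1)) x) = 2 * n + 1 :=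
  finrank_euclideanSpace_fin (𝕜 := ℝ) (n := 2 * n + 1)

/-- The value at `x` of a `1`-form, as a linear functional instead of an alternating map in one
variable. -/
def covector (α : DForm (2 * n + 1) M ℝ 1) (x : M) : TangentSpace (𝓡 (2 * n + 1)) x →ₗ[ℝ] ℝ :=
  (AlternatingMap.ofSubsingleton ℝ _ ℝ (0 : Fin 1)).symm (α x).toAlternatingMap

lemma covector_apply (α : DForm (2 * n + 1) M ℝ 1) (x : M) (v : TangentSpace (𝓡 (2 * n + 1)) x) :
    covector α x v = α x ![v] := by
  change α x (fun _ => v) = _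
  congr 1
  ext i
  fin_cases i
  rfl

/-- The alternating map `dα` at `x`, without its topology. -/
def dAt (α : DForm (2 * n + 1) M ℝ 1) (x : M) :
    TangentSpace (𝓡 (2 * n + 1)) x [⋀^Fin 2]→ₗ[ℝ] ℝ :=
  (extD α x).toAlternatingMap

lemma kappa_apply (x : M) (v w : TangentSpace (𝓡 (2 * n + 1)) x) :
    kappa α x ![v, w] = 1 / 2 * toBilin (dAt α x) v w := rfl

lemma IsContactForm.exists_volume_ne_zero (h : IsContactForm α) (x : M) :
    ∃ v, wedge (α x).toAlternatingMap (wedgePow (kappa α x).toAlternatingMap n) v ≠ 0 := by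
  by_contra! h0
  have h1 : (kappa α x).toAlternatingMap = (1 / 2 : ℝ) • dAt α x := rfl
  have h2 : wedge (α x).toAlternatingMap (wedgePow (kappa α x).toAlternatingMap n) = 0 := by
    ext v
    exact h0 v
  rw [h1, wedgePow_smul, wedge_smul_right] at h2
  exact h.nondegenerate x ((smul_eq_zero.1 h2).resolve_left (by positivity))

variable [IsManifold (𝓡 (2 * n + 1)) ∞ M]

/-- The vector field `reeb α`, which is obtained by choice, has the defining properties of the Reeb
field: a vector with these properties exists at each point. -/
lemma IsSasakian.reeb_spec (h : IsSasakian α J) (x : M) :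
    covector α x (reeb α x) = 1 ∧ ∀ w, toBilin (dAt α x) (reeb α x) w = 0 := by
  have hα : covector α x ≠ 0 := by
    intro h0
    have h1 : (α x).toAlternatingMap = 0 := by
      ext v
      have h1 : v = ![v 0] := by ext i; fin_cases i; rfl
      rw [h1]
      exact (covector_apply α x (v 0)).symm.trans (by rw [h0]; rfl)
    exact h.contact.nondegenerate x (by rw [h1, zero_wedge])
  have hex := exists_reeb_vector (covector α x) hα (dAt α x) (J x)
    (fun v hv => by
      rw [covector_apply] at hv ⊢
      exact h.calibrated.map_dist x v hv)
    (fun v hv hv0 => by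
      rw [covector_apply] at hv
      have := h.calibrated.pos x v hv hv0
      rw [kappa_apply] at this
      rw [← toBilin_apply]
      linarith)
  have := Classical.epsilon_spec (p := fun v : TangentSpace (𝓡 (2 * n + 1)) x =>
    α x ![v] = 1 ∧ ∀ w, extD α x ![v, w] = 0) (by
      obtain ⟨R, hR⟩ := hex
      exact ⟨R, by rw [← covector_apply]; exact hR.1, hR.2⟩)
  exact ⟨by rw [covector_apply]; exact this.1, this.2⟩

lemma IsSasakian.sub_mem (h : IsSasakian α J) (x : M) (v : TangentSpace (𝓡 (2 * n + 1)) x) :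
    v - covector α x v • reeb α x ∈ contactDist α x := by
  change α x ![v - covector α x v • reeb α x] = 0
  rw [← covector_apply, map_sub, map_smul, (h.reeb_spec x).1, smul_eq_mul, mul_one, sub_self]

lemma IsSasakian.map_sub (h : IsSasakian α J) (x : M) (v : TangentSpace (𝓡 (2 * n + 1)) x) :
    J x (v - covector α x v • reeb α x) = J x v := by
  rw [_root_.map_sub, map_smul, h.calibrated.map_reeb, smul_zero, sub_zero]

lemma IsSasakian.toBilin_reeb_right (h : IsSasakian α J) (x : M)
    (v : TangentSpace (𝓡 (2 * n + 1)) x) : toBilin (dAt α x) v (reeb α x) = 0 := by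
  rw [toBilin_swap, (h.reeb_spec x).2, neg_zero]

/-- As the Reeb vector is in the kernels of `J` and of `dα`, the properties of `J` on the contact
distribution give identities on the whole tangent space. -/
lemma IsSasakian.toBilin_sq (h : IsSasakian α J) (x : M)
    (v w : TangentSpace (𝓡 (2 * n + 1)) x) :
    toBilin (dAt α x) v (J x (J x w)) = -toBilin (dAt α x) v w := by
  rw [← h.map_sub x w, h.calibrated.sq x _ (h.sub_mem x w), map_neg, _root_.map_sub, map_smul,
    h.toBilin_reeb_right, smul_zero, sub_zero]

lemma IsSasakian.toBilin_symm (h : IsSasakian α J) (x : M)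
    (v w : TangentSpace (𝓡 (2 * n + 1)) x) :
    toBilin (dAt α x) v (J x w) = toBilin (dAt α x) w (J x v) := by
  have h1 : ∀ v w, toBilin (dAt α x) (v - covector α x v • reeb α x)
      (J x (w - covector α x w • reeb α x)) = toBilin (dAt α x) v (J x w) := fun v w => by
    rw [h.map_sub, _root_.map_sub, map_smul, LinearMap.sub_apply, LinearMap.smul_apply,
      (h.reeb_spec x).2, smul_zero, sub_zero]
  have h2 := h.calibrated.symm x _ (h.sub_mem x v) _ (h.sub_mem x w)
  rw [kappa_apply, kappa_apply, h1, h1] at h2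
  linarith

/-- `ε` is complex linear with respect to the extension of `J` by `J R = 0`, also on arguments
which are not tangent to the contact distribution, because it is killed by `R`. -/
lemma IsContactCalabiYau.isHolType (h : IsContactCalabiYau α J ε) (x : M) :
    IsHolType (J x).toLinearMap (ε x).toAlternatingMap := by
  have hs := h.sasakian
  intro v i
  -- All arguments are replaced by their projections to the contact distribution along `R`.
  have hproj := map_projection_eq (ε x).toAlternatingMap (reeb α x)
    (fun v i hi => h.basic_contraction x v i hi) (covector α x)
  have hmem : J x (v i) ∈ contactDist α x := by
    rw [← hs.map_sub x (v i)]
    exact hs.calibrated.map_dist x _ (hs.sub_mem x (v i))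
  have h1 : (fun j => Function.update v i (J x (v i)) j -
      covector α x (Function.update v i (J x (v i)) j) • reeb α x) =
      Function.update (fun j => v j - covector α x (v j) • reeb α x) i
        (J x (v i - covector α x (v i) • reeb α x)) := by
    ext1 j
    by_cases hj : j = i
    · subst hj
      rw [Function.update_self, Function.update_self, hs.map_sub, covector_apply,
        show α x ![J x (v j)] = 0 from hmem, zero_smul, sub_zero]
    · rw [Function.update_of_ne hj, Function.update_of_ne hj]
  rw [← hproj v, ← hproj (Function.update v i _)]
  exact (congrArg (ε x) h1).trans (h.type x (fun j => v j - covector α x (v j) • reeb α x)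
    (fun j => hs.sub_mem x (v j)) i)

lemma IsContactCalabiYau.wedge_dAt_eq_zero (h : IsContactCalabiYau α J ε) (x : M) :
    wedge (complexForm (dAt α x)) (ε x).toAlternatingMap = 0 :=
  complexForm_wedge_eq_zero (dAt α x) (fun v w => h.sasakian.toBilin_sq x v w)
    (fun v w => h.sasakian.toBilin_symm x v w) (h.isHolType x)
    (by rw [finrank_tangentSpace]; omega)

/-- The constant relating `ε ∧ ε̄` to `κⁿ`. -/
def volumeConst (n : ℕ) : ℂ := (-1) ^ (n * (n + 1) / 2) * (2 * Complex.I) ^ n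

lemma volumeConst_ne_zero (n : ℕ) : volumeConst n ≠ 0 := by
  simp [volumeConst]

/-- `α ∧ ε ∧ ε̄` is a constant multiple of the contact volume form `α ∧ κⁿ`. -/
lemma IsContactCalabiYau.wedge_volume (h : IsContactCalabiYau α J ε) (x : M)
    (v : Fin (1 + (n + n)) → TangentSpace (𝓡 (2 * n + 1)) x) :
    wedge (complexForm (α x).toAlternatingMap)
      (wedge (ε x).toAlternatingMap (conjForm (ε x).toAlternatingMap)) v =
      volumeConst n * (wedge (α x).toAlternatingMap (wedgePow (kappa α x).toAlternatingMap n)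
        (v ∘ Fin.cast (congrArg (1 + ·) (two_mul n))) : ℂ) := by
  have hvol : ∀ u : Fin (n + n) → TangentSpace (𝓡 (2 * n + 1)) x,
      wedge (ε x).toAlternatingMap (conjForm (ε x).toAlternatingMap) u =
        (volumeConst n • complexForm (wedgePow (kappa α x).toAlternatingMap n))
          (u ∘ Fin.cast (two_mul n)) := h.volume x
  rw [wedge_cast_right (two_mul n) _ _ _ hvol, wedge_csmul_right, complexForm_wedge]
  rfl

end ContactPointwise

/-! ### Exactness and Betti numbers -/

section Exactness

variable {n : ℕ} {M : Type*} [TopologicalSpace M]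
  [ChartedSpace (EuclideanSpace ℝ (Fin (2 * n + 1))) M] [IsManifold (𝓡 (2 * n + 1)) ∞ M]
  {α : DForm (2 * n + 1) M ℝ 1} {J : EndField (2 * n + 1) M} {ε : DForm (2 * n + 1) M ℂ n}

/-- Stokes' theorem for complex valued forms: the values of an exact top degree form cannot be
nonzero real multiples of one complex constant at every point. -/
lemma false_of_extD_eq_const_mul [T2Space M] [CompactSpace M] [Nonempty M] {j : ℕ} (hj : j = 2 * n)
    {γ : DForm (2 * n + 1) M ℂ j} (hγ : SmoothForm γ) {c : ℂ} (hc : c ≠ 0)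
    (h : ∀ x, ∃ v, ∃ r : ℝ, r ≠ 0 ∧ extD γ x v = c * r) : False := by
  subst hj
  let L : ℂ →L[ℝ] ℝ := Complex.reCLM ∘L (c⁻¹ • ContinuousLinearMap.id ℝ ℂ)
  obtain ⟨x, hx⟩ := exists_extD_eq_zero (hγ.map L)
  obtain ⟨v, r, hr, hv⟩ := h x
  have h1 : extD (mapForm L γ) x v = (c⁻¹ * extD γ x v).re := by rw [extD_mapForm L hγ]; rfl
  rw [hx, hv, inv_mul_cancel_left₀ hc] at h1
  exact hr h1.symm

/-- The complex conjugate of a form. -/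
def conjF {m k : ℕ} {M : Type*} [TopologicalSpace M] [ChartedSpace (EuclideanSpace ℝ (Fin m)) M]
    (θ : DForm m M ℂ k) : DForm m M ℂ k :=
  mapForm (Complex.conjCLE : ℂ →L[ℝ] ℂ) θ

/-- A real form regarded as a complex valued form. -/
def complexF {m k : ℕ} {M : Type*} [TopologicalSpace M] [ChartedSpace (EuclideanSpace ℝ (Fin m)) M]
    (θ : DForm m M ℝ k) : DForm m M ℂ k :=
  mapForm Complex.ofRealCLM θ

lemma IsContactCalabiYau.conj_closed (h : IsContactCalabiYau α J ε) : extD (conjF ε) = 0 := by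
  rw [conjF, extD_mapForm _ h.smooth, h.closed]
  funext x
  ext v
  exact map_zero (Complex.conjCLE : ℂ →L[ℝ] ℂ)

/-- The form `α ∧ ε` is closed, because `ε` is closed and `dα ∧ ε = 0`. -/
lemma IsContactCalabiYau.extD_wedge_eq_zero (h : IsContactCalabiYau α J ε) :
    extD (wedgeForm (complexF α) ε) = 0 := by
  have hα := h.sasakian.contact.smooth
  funext x
  ext v
  rw [complexF, extD_wedgeForm (hα.map _) h.smooth h.closed, extD_mapForm _ hα]
  exact DFunLike.congr_fun (h.wedge_dAt_eq_zero x) (v ∘ Fin.cast (Nat.add_right_comm 1 1 n))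

lemma IsContactCalabiYau.extD_wedge_conj_eq_zero (h : IsContactCalabiYau α J ε) :
    extD (wedgeForm (complexF α) (conjF ε)) = 0 := by
  have hα := h.sasakian.contact.smooth
  funext x
  ext v
  have hε : SmoothForm (conjF ε) := h.smooth.map _
  rw [complexF, extD_wedgeForm (hα.map _) hε h.conj_closed, extD_mapForm _ hα]
  have h1 : wedge (complexForm (dAt α x)) (conjForm (ε x).toAlternatingMap) = 0 := by
    rw [← conjForm_complexForm, conjForm_wedge, h.wedge_dAt_eq_zero]
    ext v
    simp
  exact DFunLike.congr_fun h1 (v ∘ Fin.cast (Nat.add_right_comm 1 1 n))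

/-- If `α ∧ (c₁ ε + c₂ ε̄)` is exact, then `c₁ = 0`: for a primitive `β`, the exact form
`d(β ∧ ε̄)` is a multiple of the volume form `α ∧ κⁿ` by a nonzero constant times `c₁`. -/
lemma IsContactCalabiYau.coeff_eq_zero_of_exact_wedge [T2Space M] [CompactSpace M] [Nonempty M]
    (h : IsContactCalabiYau α J ε) {c₁ c₂ : ℂ} (hc : c₂ = 0 ∨ 1 ≤ n)
    {β : DForm (2 * n + 1) M ℂ n} (hβ : SmoothForm β)
    (hd : ∀ x v, extD β x v =
      c₁ * wedgeForm (complexF α) ε x (v ∘ Fin.cast (add_comm 1 n)) +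
      c₂ * wedgeForm (complexF α) (conjF ε) x (v ∘ Fin.cast (add_comm 1 n))) : c₁ = 0 := by
  by_contra hc1
  refine false_of_extD_eq_const_mul (two_mul n).symm
    (hβ.wedge (h.smooth.map (Complex.conjCLE : ℂ →L[ℝ] ℂ)))
    (mul_ne_zero hc1 (volumeConst_ne_zero n)) fun x => ?_
  obtain ⟨u, hu⟩ := h.sasakian.contact.exists_volume_ne_zero x
  refine ⟨u ∘ Fin.cast (by omega), _, hu, ?_⟩
  rw [extD_wedgeForm hβ (h.smooth.map _) h.conj_closed]
  let A := complexForm (α x).toAlternatingMap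
  let e := (ε x).toAlternatingMap
  change wedge (extD β x).toAlternatingMap (conjForm e) _ = _
  rw [wedge_cast_left (add_comm 1 n) (wedge A (c₁ • e + c₂ • conjForm e)) _ fun v => ?_]
  · have h1 := wedge_assoc A (c₁ • e + c₂ • conjForm e) (conjForm e)
      (u ∘ Fin.cast (by omega))
    rw [wedge_conjForm_comb (h.isHolType x) c₁ c₂
      (hc.imp_right fun hn => by rw [finrank_tangentSpace]; omega), wedge_csmul_right,
      AlternatingMap.smul_apply, h.wedge_volume] at h1
    rw [mul_assoc]
    exact h1
  · rw [wedge_add_right, wedge_csmul_right, wedge_csmul_right]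
    exact hd x v

/-- If `c₁ ε + c₂ ε̄` is exact, then `c₁ = 0`: for a primitive `β`, the exact form
`d(β ∧ α ∧ ε̄)` is a multiple of the volume form `α ∧ κⁿ` by a nonzero constant times `c₁`. -/
lemma IsContactCalabiYau.coeff_eq_zero_of_exact [T2Space M] [CompactSpace M] [Nonempty M]
    (h : IsContactCalabiYau α J ε) {c₁ c₂ : ℂ} {j : ℕ} (hj : n = j + 1)
    {β : DForm (2 * n + 1) M ℂ j} (hβ : SmoothForm β)
    (hd : ∀ x v, extD β x v = c₁ * ε x (v ∘ Fin.cast hj) + c₂ * conjF ε x (v ∘ Fin.cast hj)) :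
    c₁ = 0 := by
  by_contra hc1
  have hα := h.sasakian.contact.smooth
  refine false_of_extD_eq_const_mul (j := j + (1 + n)) (by omega)
    (hβ.wedge ((hα.map Complex.ofRealCLM).wedge (h.smooth.map (Complex.conjCLE : ℂ →L[ℝ] ℂ))))
    (mul_ne_zero hc1 (volumeConst_ne_zero n)) fun x => ?_
  -- The sign of `dβ ∧ α ∧ ε̄ = ± α ∧ dβ ∧ ε̄` goes into the real factor.
  obtain ⟨s, hs⟩ := wedge_left_comm (TangentSpace (𝓡 (2 * n + 1)) x) n n 1
  obtain ⟨u, hu⟩ := h.sasakian.contact.exists_volume_ne_zero x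
  refine ⟨u ∘ Fin.cast (by omega), (s : ℤ) * _, mul_ne_zero (by simp) hu, ?_⟩
  rw [extD_wedgeForm hβ ((hα.map _).wedge (h.smooth.map _)) h.extD_wedge_conj_eq_zero]
  let A := complexForm (α x).toAlternatingMap
  let e := (ε x).toAlternatingMap
  change wedge (extD β x).toAlternatingMap (wedge A (conjForm e)) _ = _
  rw [wedge_cast_left hj (c₁ • e + c₂ • conjForm e) _ fun v => hd x v]
  have h1 := hs (c₁ • e + c₂ • conjForm e) A (conjForm e) (u ∘ Fin.cast (by omega))
  rw [wedge_conjForm_comb (h.isHolType x) c₁ c₂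
    (Or.inr (by rw [finrank_tangentSpace]; omega)), wedge_csmul_right,
    AlternatingMap.smul_apply] at h1
  refine (h1.trans (congrArg (fun z => s • (c₁ • z)) (h.wedge_volume x _))).trans ?_
  rw [Units.smul_def, zsmul_eq_mul, smul_eq_mul]
  push_cast
  exact (fun a b c d => by ring : ∀ a b c d : ℂ, a * (b * (c * d)) = b * c * (a * d)) _ _ _ _

end Exactness

section Betti

variable {m : ℕ} {M : Type*} [TopologicalSpace M] [ChartedSpace (EuclideanSpace ℝ (Fin m)) M]
  {j k : ℕ}

/-- Exactness in positive degree, in a form which allows the degree to be a successor only up to a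
propositional equality. -/
lemma exists_primitive (hjk : k = j + 1) {θ : DForm m M ℝ k} (hθ : θ ∈ exactForms m M k) :
    ∃ β : DForm m M ℝ j, SmoothForm β ∧ ∀ x v, extD β x v = θ x (v ∘ Fin.cast hjk) := by
  subst hjk
  obtain ⟨β, hβ, rfl⟩ := hθ
  exact ⟨β, hβ, fun x v => rfl⟩

lemma two_le_bettiNumber {θ η : DForm m M ℝ k} (hθ : θ ∈ closedForms m M k)
    (hη : η ∈ closedForms m M k)
    (h : ∀ s t : ℝ, s • θ + t • η ∈ exactForms m M k → s = 0 ∧ t = 0) :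
    2 ≤ bettiNumber m M k := by
  let q := ((exactForms m M k).submoduleOf (closedForms m M k)).mkQ
  have hli : LinearIndependent ℝ ![q ⟨θ, hθ⟩, q ⟨η, hη⟩] := by
    refine LinearIndependent.pair_iff.2 fun s t hst => h s t ?_
    rw [← map_smul, ← map_smul, ← map_add] at hst
    exact (Submodule.Quotient.mk_eq_zero ((exactForms m M k).submoduleOf (closedForms m M k))).1 hst
  have := hli.cardinal_lift_le_rank
  simpa [bettiNumber] using this

lemma mem_exactForms_of_bettiNumber_eq_zero (h : bettiNumber m M k = 0) {θ : DForm m M ℝ k}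
    (hθ : θ ∈ closedForms m M k) : θ ∈ exactForms m M k := by
  have : Subsingleton (DeRhamCohomology m M k) := rank_zero_iff.1 h
  have h1 : ((exactForms m M k).submoduleOf (closedForms m M k)).mkQ ⟨θ, hθ⟩ = 0 :=
    Subsingleton.elim _ _
  exact (Submodule.Quotient.mk_eq_zero ((exactForms m M k).submoduleOf (closedForms m M k))).1 h1

lemma map_mem_closedForms (L : ℂ →L[ℝ] ℝ) {θ : DForm m M ℂ k} (hθ : SmoothForm θ)
    (hd : extD θ = 0) : mapForm L θ ∈ closedForms m M k := by
  refine ⟨hθ.map L, ?_⟩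
  rw [extD_mapForm L hθ, hd]
  funext x
  ext v
  exact map_zero L

/-- A real combination of the real and the imaginary part, in terms of `z` and its conjugate. -/
lemma real_comb_eq (s t : ℝ) (z : ℂ) : ((s * z.re + t * z.im : ℝ) : ℂ) =
    ((s - t * Complex.I) / 2) * z + ((s + t * Complex.I) / 2) * starRingEnd ℂ z := by
  apply Complex.ext <;> simp <;> ring

lemma eq_zero_of_comb_eq_zero {s t : ℝ} (h : ((s : ℂ) - t * Complex.I) / 2 = 0) :
    s = 0 ∧ t = 0 := by
  have h' : (s : ℂ) - t * Complex.I = 0 := by simpa using h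
  constructor
  · simpa using congrArg Complex.re h'
  · simpa using congrArg Complex.im h'

end Betti

section MainResults

variable {n : ℕ} {M : Type*} [TopologicalSpace M]
  [ChartedSpace (EuclideanSpace ℝ (Fin (2 * n + 1))) M] [IsManifold (𝓡 (2 * n + 1)) ∞ M]
  [T2Space M] [CompactSpace M] [Nonempty M]
  {α : DForm (2 * n + 1) M ℝ 1} {J : EndField (2 * n + 1) M} {ε : DForm (2 * n + 1) M ℂ n}

/-- For `n ≥ 1` the classes of the real and imaginary parts of `α ∧ ε` are linearly independent. -/
lemma IsContactCalabiYau.two_le_bettiNumber_succ (h : IsContactCalabiYau α J ε) (hn : 1 ≤ n) :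
    2 ≤ bettiNumber (2 * n + 1) M (1 + n) := by
  have hα := h.sasakian.contact.smooth
  have hθ := (hα.map Complex.ofRealCLM).wedge h.smooth
  refine two_le_bettiNumber
    (map_mem_closedForms Complex.reCLM hθ h.extD_wedge_eq_zero)
    (map_mem_closedForms Complex.imCLM hθ h.extD_wedge_eq_zero) fun s t hst => ?_
  obtain ⟨β, hβ, hd⟩ := exists_primitive (add_comm 1 n) hst
  refine eq_zero_of_comb_eq_zero (h.coeff_eq_zero_of_exact_wedge (Or.inr hn)
    (hβ.map Complex.ofRealCLM) (c₂ := (s + t * Complex.I) / 2) fun x v => ?_)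
  rw [extD_mapForm _ hβ]
  have h1 : wedge (complexForm (α x).toAlternatingMap) (conjForm (ε x).toAlternatingMap) =
      conjForm (wedge (complexForm (α x).toAlternatingMap) (ε x).toAlternatingMap) := by
    rw [← conjForm_wedge, conjForm_complexForm]
  refine (congrArg Complex.ofReal (hd x v)).trans ((real_comb_eq s t _).trans ?_)
  exact congrArg (fun f => _ + ((s + t * Complex.I) / 2) * f (v ∘ Fin.cast (add_comm 1 n)))
    h1.symm

/-- For `n ≥ 1` the classes of the real and imaginary parts of `ε` are linearly independent. -/
lemma IsContactCalabiYau.two_le_bettiNumber (h : IsContactCalabiYau α J ε) (hn : 1 ≤ n) :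
    2 ≤ bettiNumber (2 * n + 1) M n := by
  obtain ⟨j, hj⟩ : ∃ j, n = j + 1 := ⟨n - 1, by omega⟩
  refine ContactCY.two_le_bettiNumber
    (map_mem_closedForms Complex.reCLM h.smooth h.closed)
    (map_mem_closedForms Complex.imCLM h.smooth h.closed) fun s t hst => ?_
  obtain ⟨β, hβ, hd⟩ := exists_primitive hj hst
  refine eq_zero_of_comb_eq_zero (h.coeff_eq_zero_of_exact hj
    (hβ.map Complex.ofRealCLM) (c₂ := (s + t * Complex.I) / 2) fun x v => ?_)
  rw [extD_mapForm _ hβ]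
  exact (congrArg Complex.ofReal (hd x v)).trans (real_comb_eq s t _)

/-- The real and imaginary parts of `α ∧ ε` are not both exact. This includes the case `n = 0`,
where `ε̄ ∧ ε̄` need not vanish and the two parts need not be linearly independent. -/
lemma IsContactCalabiYau.bettiNumber_succ_ne_zero (h : IsContactCalabiYau α J ε) :
    bettiNumber (2 * n + 1) M (1 + n) ≠ 0 := by
  intro h0
  have hα := h.sasakian.contact.smooth
  have hθ := (hα.map Complex.ofRealCLM).wedge h.smooth
  obtain ⟨β₁, hβ₁, hd₁⟩ := exists_primitive (add_comm 1 n)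
    (mem_exactForms_of_bettiNumber_eq_zero h0
      (map_mem_closedForms Complex.reCLM hθ h.extD_wedge_eq_zero))
  obtain ⟨β₂, hβ₂, hd₂⟩ := exists_primitive (add_comm 1 n)
    (mem_exactForms_of_bettiNumber_eq_zero h0
      (map_mem_closedForms Complex.imCLM hθ h.extD_wedge_eq_zero))
  let L : ℝ →L[ℝ] ℂ := ContinuousLinearMap.toSpanSingleton ℝ Complex.I
  refine one_ne_zero (h.coeff_eq_zero_of_exact_wedge (c₁ := 1) (c₂ := 0) (Or.inl rfl)
    ((hβ₁.map Complex.ofRealCLM).add (hβ₂.map L)) fun x v => ?_)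
  rw [extD_add (hβ₁.map _) (hβ₂.map _), extD_mapForm _ hβ₁, extD_mapForm _ hβ₂]
  change Complex.ofReal (extD β₁ x v) + (extD β₂ x v) • Complex.I = _
  rw [hd₁, hd₂, one_mul, zero_mul, add_zero, Complex.real_smul]
  exact Complex.re_add_im _

end MainResults

end ContactCY

end

theorem mainTheorem3 (n : ℕ) (M : Type*) [TopologicalSpace M]
    [ChartedSpace (EuclideanSpace ℝ (Fin (2 * n + 1))) M] [IsManifold (𝓡 (2 * n + 1)) ∞ M]
    [T2Space M] [CompactSpace M] [Nonempty M]
    (h : ContactCY.AdmitsContactCalabiYau n M) :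
    (Even n → 0 < ContactCY.bettiNumber (2 * n + 1) M (n + 1)) ∧
    (Odd n → 2 ≤ ContactCY.bettiNumber (2 * n + 1) M n ∧
      2 ≤ ContactCY.bettiNumber (2 * n + 1) M (n + 1)) := by
  obtain ⟨α, J, ε, h⟩ := h
  rw [add_comm n 1]
  exact ⟨fun _ => pos_iff_ne_zero.2 h.bettiNumber_succ_ne_zero, fun hn =>
    ⟨h.two_le_bettiNumber hn.pos, h.two_le_bettiNumber_succ hn.pos⟩⟩
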